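/- **Setting.** Let $M$ be a (Hausdorff, second countable) real analytic manifold of dimension $d$, $\mathcal H'$ a complex Hilbert space and $\mathcal F\to M$ a real analytic Hilbert bundle with fibres $\mathcal F_k\simeq\mathcal H'$ (given by unitary local trivializations whose transition functions are real analytic in operator norm). For $k\in M$ let $H_0(k)$ be a self-adjoint operator in $\mathcal F_k$ such that $(H_0(k)+i)^{-1}$ is a real analytic section of the compact operators of $\mathcal F$. Put $\Sigma=\{(k,\lambda)\in M\times\mathbb R:\lambda\in\mathrm{Spec}(H_0(k))\}$, $p:\Sigma\to\mathbb R$, $p(k,\lambda)=\lambda$, and assume that $p$ is proper. Let $\Sigma_\mu\subset\Sigma$ be the set of $(k,\lambda)$ for which the eigenvalue $\lambda$ of $H_0(k)$ has multiplicity $\mu$. Write $\partial S=\overline S\setminus S$, and $A\Subset B$ if $\overline A$ is compact and contained in $B$. Let $\mathcal S$ be a locally finite stratification of $\Sigma$ compatible with $p$: $\Sigma$ is the disjoint union of the $S\in\mathcal S$, each $S$ is a connected real analytic manifold embedded in $M\times\mathbb R$; if $\overline S\cap S'\ne\emptyset$ then $S'=S$ or $S'\subset\partial S$; each $S$ is contained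 in some $\Sigma_{\mu_S}$; and for each $S$ either $p(S)$ is an open interval and $dp|_{TS}$ has rank $1$ everywhere, or $p(S)$ is a single point and $dp|_{TS}$ has rank $0$ everywhere. Let $\tau$ be the union of the sets $p(S)$ over the strata with $\mathrm{rank}\,dp|_{TS}=0$. For an interval $I$ let $\mathcal S_I=\{S\in\mathcal S:\overline S\cap p^{-1}(\overline I)\neq\emptyset\}$. **Proposition.** Let $I,\tilde I$ be open intervals with $I\Subset\tilde I\Subset\mathbb R\setminus\tau$. There exist finitely many open sets $\omega_m\Subset M$, $1\le m\le M_I$, and open intervals $J_{m,n}\Subset\tilde I$, $1\le n\le N_m$, such that, with $\Omega_{m,n}=\omega_m\times J_{m,n}$: 1. $p^{-1}(\overline I)\subset\bigcup_{m,n}\Omega_{m,n}$; 2. $J_{m,n}\cap J_{m,n'}=\emptyset$ for $n\ne n'$; 3. for every $(m,n)$ there is a unique stratum $S_{m,n}\in\mathcal S_I$ meeting $\Omega_{m,n}$ such that $\Omega_{m,n}\cap\Sigma$ is a finite union of sets $\Omega_{m,n}\cap S'$ with $S'\in\mathcal S_I$, $S'=S_{m,n}$ being one of them, and each of these $S'$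 satisfies $S'=S_{m,n}$ or $S_{m,n}\subset\partial S'$; moreover $dp|_{TS_{m,n}}$ has rank $1$ everywhere; 4. the spectral projection $1_{J_{m,n}}(H_0(k))$ has a constant finite rank $\mu_{m,n}$ for $k\in\omega_m$, and there is an open interval $J'_{m,n}\Subset J_{m,n}$ with $1_{J_{m,n}}(H_0(k))=1_{J'_{m,n}}(H_0(k))$ for all $k\in\omega_m$; 5. there is a real analytic section $W_{m,n}$ of $\mathcal L(\mathbb C^{\mu_{m,n}};\mathcal F|_{\omega_m})$ such that $W_{m,n}(k):\mathbb C^{\mu_{m,n}}\to\mathrm{Ran}\,1_{J_{m,n}}(H_0(k))$ is unitary for all $k\in\omega_m$ and $\tilde H_{m,n}(k)=W_{m,n}(k)^*H_0(k)1_{J_{m,n}}(H_0(k))W_{m,n}(k)$ is a real analytic $\mu_{m,n}\times\mu_{m,n}$ matrix on $\omega_m$; 6. there is a real analytic vector field $X_{m,n}$ on $\omega_m$ such that, for all $k\in\omega_m$, $X_{m,n}\tilde H_{m,n}(k)\ge\frac12\mathrm{Id}_{\mathbb C^{\mu_{m,n}}}$ and $\bigl(\nabla_{X_{m,n}}[H_0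 1_{J_{m,n}}(H_0)]\bigr)(k)\ge\frac12 1_{J_{m,n}}(H_0(k))$. Here, on smooth sections $s$ of $\mathrm{Ran}\,1_{J_{m,n}}(H_0)$ over $\omega_m$, $\nabla_X s=W_{m,n}X(W_{m,n}^*s)$, and $\nabla_X$ acts on endomorphisms $A$ of this bundle by $(\nabla_XA)s=\nabla_X(As)-A(\nabla_Xs)$, extended by $0$ on the orthogonal complement; 7. if $\Omega_{m,n}\cap\Omega_{m',n'}\cap\Sigma\neq\emptyset$ and $\mu_{m,n}\ge\mu_{m',n'}$, then $1_{J_{m,n}}(H_0(k))1_{J_{m',n'}}(H_0(k))=1_{J_{m',n'}}(H_0(k))$ for all $k\in\omega_m\cap\omega_{m'}$, and one of the following holds: $S_{m,n}\subset\partial S_{m',n'}$; or $S_{m',n'}\subset\partial S_{m,n}$ and $\mu_{m,n}=\mu_{m',n'}$; or $S_{m',n'}=S_{m,n}$ and $\mu_{m,n}=\mu_{m',n'}$. -/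

import Mathlib

open Set Filter Topology
open scoped Manifold ContDiff

noncomputable section

namespace FiberedOperator

/-! ### Real analytic Hilbert bundles -/

/-- A fibrewise unitary identification of the family of Hilbert spaces `F k` with the model Hilbert
space `H'`; only its values over the set `base` matter. -/
structure UnitaryTriv {M : Type*} (F : M → Type*) [∀ k, NormedAddCommGroup (F k)]
    [∀ k, InnerProductSpace ℂ (F k)] (H' : Type*) [NormedAddCommGroup H']
    [InnerProductSpace ℂ H'] where
  /-- the set over which the trivialization is used -/
  base : Set M
  /-- the unitary map `F k → H'` -/
  map : ∀ k, F k ≃ₗᵢ[ℂ] H'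

/-- A real analytic Hilbert bundle structure on the family `F` of complex Hilbert spaces over the
real analytic manifold `M`: an atlas of unitary local trivializations whose transition functions
are real analytic for the operator norm. -/
structure HilbertBundleAtlas (d : ℕ) {M : Type*} [TopologicalSpace M]
    [ChartedSpace (EuclideanSpace ℝ (Fin d)) M] (F : M → Type*) [∀ k, NormedAddCommGroup (F k)]
    [∀ k, InnerProductSpace ℂ (F k)] (H' : Type*) [NormedAddCommGroup H']
    [InnerProductSpace ℂ H'] where
  /-- the local trivializations -/
  trivs : Set (UnitaryTriv F H')
  isOpen_base : ∀ e ∈ trivs, IsOpen e.base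
  cover : ∀ k : M, ∃ e ∈ trivs, k ∈ e.base
  analytic_transition : ∀ e ∈ trivs, ∀ e' ∈ trivs,
    ContMDiffOn (𝓡 d) 𝓘(ℝ, H' →L[ℂ] H') ω
      (fun k => (((e.map k).symm.trans (e'.map k)).toContinuousLinearEquiv : H' →L[ℂ] H'))
      (e.base ∩ e'.base)

section Sections

variable {d : ℕ} {M : Type*} [TopologicalSpace M] [ChartedSpace (EuclideanSpace ℝ (Fin d)) M]
  {F : M → Type*} [∀ k, NormedAddCommGroup (F k)] [∀ k, InnerProductSpace ℂ (F k)]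
  {H' : Type*} [NormedAddCommGroup H'] [InnerProductSpace ℂ H']

/-- `s` is a smooth section of the bundle over `U`. -/
def HilbertBundleAtlas.IsSmoothSection (𝒜 : HilbertBundleAtlas d F H') (U : Set M)
    (s : ∀ k, F k) : Prop :=
  ∀ e ∈ 𝒜.trivs, ContMDiffOn (𝓡 d) 𝓘(ℝ, H') ∞ (fun k => e.map k (s k)) (U ∩ e.base)

/-- `W` is a real analytic section of `L(E; F)` over `U`, for a fixed space `E`. -/
def HilbertBundleAtlas.IsAnalyticHom (𝒜 : HilbertBundleAtlas d F H') {E : Type*}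
    [NormedAddCommGroup E] [InnerProductSpace ℂ E] (U : Set M) (W : ∀ k, E →L[ℂ] F k) : Prop :=
  ∀ e ∈ 𝒜.trivs, ContMDiffOn (𝓡 d) 𝓘(ℝ, E →L[ℂ] H') ω
    (fun k => ((e.map k).toContinuousLinearEquiv : F k →L[ℂ] H') ∘L W k) (U ∩ e.base)

/-- `R` is a real analytic section of `L(F)` over `U`. -/
def HilbertBundleAtlas.IsAnalyticEnd (𝒜 : HilbertBundleAtlas d F H') (U : Set M)
    (R : ∀ k, F k →L[ℂ] F k) : Prop :=
  ∀ e ∈ 𝒜.trivs, ContMDiffOn (𝓡 d) 𝓘(ℝ, H' →L[ℂ] H') ω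
    (fun k => ((e.map k).toContinuousLinearEquiv : F k →L[ℂ] H') ∘L R k ∘L
      ((e.map k).symm.toContinuousLinearEquiv : H' →L[ℂ] F k)) (U ∩ e.base)

end Sections

/-! ### Unbounded operators -/

section Unbounded

variable {E : Type*} [NormedAddCommGroup E] [InnerProductSpace ℂ E]

/-- `R` is the bounded inverse of `A - z`. -/
def IsResolvent (A : E →ₗ.[ℂ] E) (z : ℂ) (R : E →L[ℂ] E) : Prop :=
  (∀ v : E, ∃ h : R v ∈ A.domain, A ⟨R v, h⟩ - z • R v = v) ∧
    ∀ u : A.domain, R (A u - z • (u : E)) = u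

/-- The real spectrum of `A` (all of the spectrum, when `A` is self-adjoint). -/
def realSpectrum (A : E →ₗ.[ℂ] E) : Set ℝ :=
  {l | ¬ ∃ R : E →L[ℂ] E, IsResolvent A (l : ℂ) R}

/-- `ker (A - l)`, as a subspace of the whole space. -/
def eigenspace (A : E →ₗ.[ℂ] E) (l : ℝ) : Submodule ℂ E :=
  (LinearMap.ker (A.toFun - (l : ℂ) • A.domain.subtype)).map A.domain.subtype

/-- The spectral projection `1_J(A)` of a self-adjoint operator with compact resolvent: the
orthogonal projection on the closed span of the eigenvectors with eigenvalue in `J`. -/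
def spectralProj [CompleteSpace E] (A : E →ₗ.[ℂ] E) (J : Set ℝ) : E →L[ℂ] E :=
  (⨆ l ∈ J, eigenspace A l).topologicalClosure.starProjection

/-- `B` is the bounded operator `A 1_J(A)`. -/
def IsSpectralPart [CompleteSpace E] (A : E →ₗ.[ℂ] E) (J : Set ℝ) (B : E →L[ℂ] E) : Prop :=
  ∀ v : E, ∃ h : spectralProj A J v ∈ A.domain, A ⟨spectralProj A J v, h⟩ = B v

end Unbounded

/-! ### Analytically fibered operators -/

section Fibered

variable {d : ℕ} {M : Type*} [TopologicalSpace M] [ChartedSpace (EuclideanSpace ℝ (Fin d)) M]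
  {F : M → Type*} [∀ k, NormedAddCommGroup (F k)] [∀ k, InnerProductSpace ℂ (F k)]
  {H' : Type*} [NormedAddCommGroup H'] [InnerProductSpace ℂ H']

/-- The characteristic variety `Σ = {(k, l) : l ∈ Spec H₀(k)}`. -/
def charVariety (H₀ : ∀ k, F k →ₗ.[ℂ] F k) : Set (M × ℝ) :=
  {x | x.2 ∈ realSpectrum (H₀ x.1)}

/-- The part `Σ_μ` of the characteristic variety where the eigenvalue has multiplicity `μ`. -/
def multStratum (H₀ : ∀ k, F k →ₗ.[ℂ] F k) (μ : ℕ) : Set (M × ℝ) :=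
  {x | x ∈ charVariety H₀ ∧ Module.rank ℂ (eigenspace (H₀ x.1) x.2) = μ}

/-- The preimage of `B` under the projection `Σ → ℝ`. -/
def energyPreimage (H₀ : ∀ k, F k →ₗ.[ℂ] F k) (B : Set ℝ) : Set (M × ℝ) :=
  {x | x ∈ charVariety H₀ ∧ x.2 ∈ B}

/-- Analytically fibered families of self-adjoint operators: `H₀(k)` is self-adjoint,
`(H₀(k) + i)⁻¹` is a real analytic section of compact operators, and `Σ → ℝ` is proper. -/
structure IsAnalyticallyFibered [∀ k, CompleteSpace (F k)] (𝒜 : HilbertBundleAtlas d F H')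
    (H₀ : ∀ k, F k →ₗ.[ℂ] F k) : Prop where
  selfAdjoint : ∀ k, IsSelfAdjoint (H₀ k)
  resolvent : ∃ R : ∀ k, F k →L[ℂ] F k, (∀ k, IsResolvent (H₀ k) (-Complex.I) (R k)) ∧
    (∀ k, IsCompactOperator (R k)) ∧ 𝒜.IsAnalyticEnd univ R
  proper : IsProperMap (fun x : charVariety H₀ => (x : M × ℝ).2)

end Fibered

/-! ### Stratifications -/

section Strata

variable (d : ℕ) {M : Type*} [TopologicalSpace M] [ChartedSpace (EuclideanSpace ℝ (Fin d)) M]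

/-- `S` is an embedded real analytic submanifold of `M × ℝ` (of constant codimension `c`): it is
locally the zero set of a real analytic submersion with values in `ℝ^c`. -/
def IsAnalyticSubmanifold (S : Set (M × ℝ)) : Prop :=
  ∃ c : ℕ, ∀ x ∈ S, ∃ U : Set (M × ℝ), IsOpen U ∧ x ∈ U ∧
    ∃ f : M × ℝ → EuclideanSpace ℝ (Fin c),
      ContMDiffOn ((𝓡 d).prod 𝓘(ℝ, ℝ)) 𝓘(ℝ, EuclideanSpace ℝ (Fin c)) ω f U ∧
      (∀ y ∈ U, Function.Surjective
        (mfderiv ((𝓡 d).prod 𝓘(ℝ, ℝ)) 𝓘(ℝ, EuclideanSpace ℝ (Fin c)) f y)) ∧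
      S ∩ U = {y ∈ U | f y = 0}

/-- The tangent space `T_x S` of a submanifold `S` of `M × ℝ`: the velocities at `x` of the
curves in `S` through `x`. -/
def tangentTo (S : Set (M × ℝ)) (x : M × ℝ) : Set (TangentSpace ((𝓡 d).prod 𝓘(ℝ, ℝ)) x) :=
  {v | ∃ γ : ℝ → M × ℝ, γ 0 = x ∧ (∀ᶠ t in 𝓝 (0 : ℝ), γ t ∈ S) ∧
    HasMFDerivAt 𝓘(ℝ, ℝ) ((𝓡 d).prod 𝓘(ℝ, ℝ)) γ 0 (ContinuousLinearMap.toSpanSingleton ℝ v)}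

/-- The differential at `x` of the projection `M × ℝ → ℝ`. -/
def dEnergy (x : M × ℝ) (v : TangentSpace ((𝓡 d).prod 𝓘(ℝ, ℝ)) x) : ℝ :=
  mfderiv ((𝓡 d).prod 𝓘(ℝ, ℝ)) 𝓘(ℝ, ℝ) (Prod.snd : M × ℝ → ℝ) x v

/-- The differential of the energy restricted to `TS` has rank `1` at every point of `S`. -/
def EnergyRankOne (S : Set (M × ℝ)) : Prop :=
  ∀ x ∈ S, ∃ v ∈ tangentTo d S x, dEnergy d x v ≠ 0

/-- The differential of the energy restricted to `TS` has rank `0` at every point of `S`. -/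
def EnergyRankZero (S : Set (M × ℝ)) : Prop :=
  ∀ x ∈ S, ∀ v ∈ tangentTo d S x, dEnergy d x v = 0

variable {F : M → Type*} [∀ k, NormedAddCommGroup (F k)] [∀ k, InnerProductSpace ℂ (F k)]

/-- A locally finite stratification of the characteristic variety into connected embedded analytic
manifolds, compatible with the multiplicity and with the projection on the energy axis. -/
structure IsStratification (H₀ : ∀ k, F k →ₗ.[ℂ] F k) (𝒮 : Set (Set (M × ℝ))) : Prop where
  sUnion_eq : ⋃₀ 𝒮 = charVariety H₀
  disjoint : ∀ S ∈ 𝒮, ∀ S' ∈ 𝒮, S ≠ S' → Disjoint S S'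
  connected : ∀ S ∈ 𝒮, IsConnected S
  submanifold : ∀ S ∈ 𝒮, IsAnalyticSubmanifold d S
  locallyFinite : LocallyFinite (fun S : 𝒮 => (S : Set (M × ℝ)))
  frontier : ∀ S ∈ 𝒮, ∀ S' ∈ 𝒮, (closure S ∩ S').Nonempty → S' = S ∨ S' ⊆ closure S \ S
  multiplicity : ∀ S ∈ 𝒮, ∃ μ : ℕ, S ⊆ multStratum H₀ μ
  energy : ∀ S ∈ 𝒮,
    (IsOpen (Prod.snd '' S) ∧ (Prod.snd '' S).OrdConnected ∧ EnergyRankOne d S) ∨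
      ((∃ c : ℝ, Prod.snd '' S = {c}) ∧ EnergyRankZero d S)

/-- The set `τ` of thresholds: the energies of the strata on which the energy has rank `0`. -/
def thresholds (𝒮 : Set (Set (M × ℝ))) : Set ℝ :=
  {l | ∃ S ∈ 𝒮, EnergyRankZero d S ∧ l ∈ Prod.snd '' S}

end Strata

section Covering

variable {M : Type*} [TopologicalSpace M] {F : M → Type*} [∀ k, NormedAddCommGroup (F k)]
  [∀ k, InnerProductSpace ℂ (F k)]

/-- The strata whose closure meets the part of the characteristic variety over `closure I`. -/
def strataOver (H₀ : ∀ k, F k →ₗ.[ℂ] F k) (𝒮 : Set (Set (M × ℝ))) (I : Set ℝ) :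
    Set (Set (M × ℝ)) :=
  {S ∈ 𝒮 | (closure S ∩ energyPreimage H₀ (closure I)).Nonempty}

/-- `S` is a stratum associated with the cell `Ω`: it is one of the finitely many strata whose
traces make up `Ω ∩ Σ`, and it lies in the closure of all of them. -/
def IsAssociatedStratum (H₀ : ∀ k, F k →ₗ.[ℂ] F k) (𝒮 : Set (Set (M × ℝ))) (I : Set ℝ)
    (Ω : Set (M × ℝ)) (S : Set (M × ℝ)) : Prop :=
  (Ω ∩ S).Nonempty ∧ ∃ T : Set (Set (M × ℝ)), T.Finite ∧ T ⊆ strataOver H₀ 𝒮 I ∧ S ∈ T ∧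
    Ω ∩ charVariety H₀ = ⋃ S' ∈ T, Ω ∩ S' ∧
    ∀ S' ∈ T, S' = S ∨ S ⊆ closure S' \ S'

end Covering

/-- `A ⋐ B`: the closure of `A` is compact and contained in `B`. -/
def CompactlyIn {X : Type*} [TopologicalSpace X] (A B : Set X) : Prop :=
  IsCompact (closure A) ∧ closure A ⊆ B

/-- Open intervals of `ℝ`. -/
def IsOpenInterval (I : Set ℝ) : Prop :=
  IsOpen I ∧ I.OrdConnected

/-! ### Derivatives along vector fields -/

section Derivative

variable {d : ℕ} {M : Type*} [TopologicalSpace M] [ChartedSpace (EuclideanSpace ℝ (Fin d)) M]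

/-- `X` is a real analytic vector field on `U`. -/
def IsAnalyticVectorField [IsManifold (𝓡 d) ω M] (U : Set M)
    (X : ∀ k : M, TangentSpace (𝓡 d) k) : Prop :=
  ContMDiffOn (𝓡 d) (𝓡 d).tangent ω (fun k => (⟨k, X k⟩ : TangentBundle (𝓡 d) M)) U

/-- The derivative `X f` of a vector-valued function along the vector field `X`. -/
def derivAlong {V : Type*} [NormedAddCommGroup V] [NormedSpace ℝ V]
    (X : ∀ k : M, TangentSpace (𝓡 d) k) (f : M → V) (k : M) : V :=
  mfderiv (𝓡 d) 𝓘(ℝ, V) f k (X k)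

variable {F : M → Type*} [∀ k, NormedAddCommGroup (F k)] [∀ k, InnerProductSpace ℂ (F k)]
  [∀ k, CompleteSpace (F k)] {H' : Type*} [NormedAddCommGroup H'] [InnerProductSpace ℂ H']

/-- The covariant derivative `W ∘ X ∘ W^*` of sections of the bundle `Ran W`. -/
def covDeriv {μ : ℕ} (W : ∀ k, EuclideanSpace ℂ (Fin μ) →L[ℂ] F k)
    (X : ∀ k : M, TangentSpace (𝓡 d) k) (s : ∀ k, F k) (k : M) : F k :=
  W k (derivAlong X (fun q => ContinuousLinearMap.adjoint (W q) (s q)) k)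

/-- `B` is the covariant derivative `[W ∘ X ∘ W^*] A` over `U` of the field `A` of endomorphisms
of the bundle `Ran P`, `P = W W^*`, extended by `0` to the orthogonal complement of `Ran P`.
It is given by the Leibniz rule `(∇_X A) s = ∇_X (A s) - A (∇_X s)`. -/
def IsEndCovDeriv (𝒜 : HilbertBundleAtlas d F H') (U : Set M) {μ : ℕ}
    (W : ∀ k, EuclideanSpace ℂ (Fin μ) →L[ℂ] F k) (X : ∀ k : M, TangentSpace (𝓡 d) k)
    (P A B : ∀ k, F k →L[ℂ] F k) : Prop :=
  (∀ k ∈ U, B k = P k ∘L B k ∘L P k) ∧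
    ∀ s : ∀ k, F k, 𝒜.IsSmoothSection U s → (∀ k ∈ U, P k (s k) = s k) →
      ∀ k ∈ U, B k (s k) =
        covDeriv W X (fun q => A q (s q)) k - A k (covDeriv W X s k)

end Derivative

end FiberedOperator

end

/-! Near a point `x = (k₀, l₀)` of the characteristic variety, with multiplicity `μ`, the problem
reduces to an analytic `μ × μ` matrix. The compact resolvent `T = (H₀ + i)⁻¹` has the eigenvalue
`(l₀ + i)⁻¹`. The implicit function theorem applied to `T V = V L` gives an invariant frame `V` and
a matrix `L` analytic in `T`; the linearized equation is solvable because a bordered (Grushin)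
operator is invertible. Orthonormalizing by `(V†V)^(-1/2)` gives `W`, in which `H₀` acts as `h = L⁻¹
- i`, and injectivity of the bordered operator nearby shows that `W` captures every eigenvector with
energy close to `l₀` (`exists_isLocalFrame`).

Along the stratum `S` of `x` the multiplicity stays equal to `μ`, so `h` is there the energy times
the identity. A tangent direction in which the energy varies therefore differentiates `h` to a
nonzero multiple of the identity. Rescaled to give the identity itself and extended to an analytic
field, it gives a derivative at least `1/2` near `k₀` (`IsLocalFrame.exists_vectorField`).

A cell is an interval of radius `ε` about `l₀` over a base so small that the spectrum in the
interval stays within `ε / 10` of the center. Thus cells that overlap on the variety have nested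
spectral projections as soon as their radii are ordered (`Cell.IsAdapted.spectralProj_comp`). The
covering is built stratum by stratum, frontier strata first
(`IsStratification.exists_cellCover_insert`): new cells are no longer than the old ones and avoid
those whose strata are not in the frontier of the current stratum. Overlapping cells then have equal
or adjacent strata. Semicontinuity of the multiplicity settles the cases where the radii are ordered
the wrong way: the ranks are then equal, and nested projections of equal rank coincide. -/

noncomputable section

namespace FiberedOperator

/-! ### Invertibility of the bordered (Grushin) operator. -/

section BorderedOperator

variable {E : Type*} [NormedAddCommGroup E] [InnerProductSpace ℂ E] [CompleteSpace E]
  {C : Type*} [NormedAddCommGroup C] [InnerProductSpace ℂ C] [CompleteSpace C]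

/-- The bordered operator with blocks `T - r`, `-V`, `V†` and `0`. -/
def bordered (T : E →L[ℂ] E) (r : ℂ) (V : C →L[ℂ] E) : (E × C) →L[ℂ] (E × C) :=
  ((T - r • ContinuousLinearMap.id ℂ E) ∘L ContinuousLinearMap.fst ℂ E C
    - V ∘L ContinuousLinearMap.snd ℂ E C).prod
    (ContinuousLinearMap.adjoint V ∘L ContinuousLinearMap.fst ℂ E C)

theorem bordered_apply (T : E →L[ℂ] E) (r : ℂ) (V : C →L[ℂ] E) (x : E × C) :
    bordered T r V x = (T x.1 - r • x.1 - V x.2, ContinuousLinearMap.adjoint V x.1) := by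
  simp [bordered]

theorem continuous_bordered :
    Continuous fun q : (E →L[ℂ] E) × ℂ × (C →L[ℂ] E) => bordered q.1 q.2.1 q.2.2 := by
  have : Continuous fun q : (E →L[ℂ] E) × ℂ × (C →L[ℂ] E) =>
      ContinuousLinearMap.inl ℂ E C ∘L
        ((q.1 - q.2.1 • ContinuousLinearMap.id ℂ E) ∘L ContinuousLinearMap.fst ℂ E C
          - q.2.2 ∘L ContinuousLinearMap.snd ℂ E C) +
      ContinuousLinearMap.inr ℂ E C ∘L
        (ContinuousLinearMap.adjoint q.2.2 ∘L ContinuousLinearMap.fst ℂ E C) := by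
    have h : Continuous fun q : (E →L[ℂ] E) × ℂ × (C →L[ℂ] E) =>
        ContinuousLinearMap.adjoint q.2.2 :=
      (ContinuousLinearMap.adjoint (𝕜 := ℂ) (E := C) (F := E)).continuous.comp
        (continuous_snd.comp continuous_snd)
    fun_prop
  refine this.congr fun q => ?_
  ext x <;> simp [bordered]

/-- Pairing the first component with `V a` removes `T - r`, by `hT`, and leaves `‖V a‖² = 0`. Then
`v` is an eigenvector, so it lies in the range of `V`, where the second component detects it. -/
theorem bordered_injective {T : E →L[ℂ] E} {r : ℂ} {V : C →L[ℂ] E}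
    (hV : ContinuousLinearMap.adjoint V ∘L V = ContinuousLinearMap.id ℂ C)
    (hT : ∀ c v, inner ℂ (V c) (T v) = r * inner ℂ (V c) v)
    (hr : ∀ v, T v = r • v → v ∈ range V) :
    Function.Injective (bordered T r V) := by
  rw [injective_iff_map_eq_zero]
  rintro ⟨v, a⟩ h
  rw [bordered_apply, Prod.mk_eq_zero] at h
  obtain ⟨h1, h2⟩ := h
  have hVV : ∀ c, ContinuousLinearMap.adjoint V (V c) = c := fun c => DFunLike.congr_fun hV c
  have ha : a = 0 := by
    have h3 : V a = T v - r • v := (sub_eq_zero.1 h1).symm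
    have h4 : inner ℂ (V a) (V a) = 0 := by
      nth_rw 2 [h3]
      rw [inner_sub_right, hT, inner_smul_right, sub_self]
    rw [inner_self_eq_zero] at h4
    rw [← hVV a, h4, map_zero]
  subst ha
  have h5 : T v = r • v := by simpa [sub_eq_zero] using h1
  obtain ⟨c, rfl⟩ := hr v h5
  simp only [hVV] at h2
  simp [h2]

/-- Fredholm alternative: the operator is a compact one minus `r` times the identity, with `r ≠ 0`,
so injectivity suffices. -/
theorem isUnit_bordered [FiniteDimensional ℂ C] {T : E →L[ℂ] E} (hTc : IsCompactOperator T)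
    {r : ℂ} (hr0 : r ≠ 0) {V : C →L[ℂ] E} (hinj : Function.Injective (bordered T r V)) :
    IsUnit (bordered T r V) := by
  -- The extra `r` on the `C` factor compensates the `-r` of the identity there; it is compact since
  -- `C` is finite dimensional.
  set K : (E × C) →L[ℂ] (E × C) :=
    ContinuousLinearMap.inl ℂ E C ∘L (T ∘L ContinuousLinearMap.fst ℂ E C) +
    (ContinuousLinearMap.inr ℂ E C ∘L (ContinuousLinearMap.adjoint V ∘L
      ContinuousLinearMap.fst ℂ E C + r • ContinuousLinearMap.snd ℂ E C) -
      ContinuousLinearMap.inl ℂ E C ∘L (V ∘L ContinuousLinearMap.snd ℂ E C)) with hK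
  have hB : bordered T r V = K - r • ContinuousLinearMap.id ℂ (E × C) := by
    ext x <;> simp [bordered, hK]
  have hfin : ∀ L : (E × C) →L[ℂ] C, IsCompactOperator L := fun L => by
    have : ProperSpace C := FiniteDimensional.proper ℂ C
    refine ⟨Metric.closedBall 0 1, isCompact_closedBall 0 1, ?_⟩
    exact L.continuous.continuousAt.preimage_mem_nhds
      (by rw [map_zero]; exact Metric.closedBall_mem_nhds 0 one_pos)
  have hKc : IsCompactOperator K := by
    refine IsCompactOperator.add ?_ (IsCompactOperator.sub ?_ ?_)
    · exact (hTc.comp_clm (ContinuousLinearMap.fst ℂ E C)).clm_comp (ContinuousLinearMap.inl ℂ E C)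
    · exact (hfin _).clm_comp (ContinuousLinearMap.inr ℂ E C)
    · exact ((hfin _).clm_comp V).clm_comp (ContinuousLinearMap.inl ℂ E C)
  rcases hKc.hasEigenvalue_or_mem_resolventSet hr0 with h | h
  · exfalso
    obtain ⟨v, hv⟩ := h.exists_hasEigenvector
    refine hv.2 (hinj ?_)
    have : K v = r • v := hv.apply_eq_smul
    rw [hB, map_zero]
    simp [this]
  · rw [spectrum.mem_resolventSet_iff, ← IsUnit.neg_iff] at h
    convert h using 1
    rw [hB, neg_sub, Algebra.algebraMap_eq_smul_one]
    rfl

end BorderedOperator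

/-! ### Analytic invariant frames from the implicit function theorem. -/

section AnalyticFrame

/-- The map `A ↦ A†` as a continuous real linear map. -/
def adjointReal (E C : Type*) [NormedAddCommGroup E] [InnerProductSpace ℂ E] [CompleteSpace E]
    [NormedAddCommGroup C] [InnerProductSpace ℂ C] [CompleteSpace C] :
    (C →L[ℂ] E) →L[ℝ] (E →L[ℂ] C) where
  toFun A := ContinuousLinearMap.adjoint A
  map_add' := map_add _
  map_smul' r A := by
    rw [← Complex.coe_smul r A, map_smulₛₗ, Complex.conj_ofReal, Complex.coe_smul]
    rfl
  cont := (ContinuousLinearMap.adjoint (𝕜 := ℂ) (E := C) (F := E)).continuous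

@[simp] theorem adjointReal_apply {E C : Type*} [NormedAddCommGroup E] [InnerProductSpace ℂ E]
    [CompleteSpace E] [NormedAddCommGroup C] [InnerProductSpace ℂ C] [CompleteSpace C]
    (A : C →L[ℂ] E) : adjointReal E C A = ContinuousLinearMap.adjoint A := rfl

/-- The composition of complex linear operators is smooth over the reals. -/
theorem contDiff_real_comp {A B D : Type*} [NormedAddCommGroup A] [InnerProductSpace ℂ A]
    [NormedAddCommGroup B] [InnerProductSpace ℂ B] [NormedAddCommGroup D]
    [InnerProductSpace ℂ D] {n : ℕ∞ω} :
    ContDiff ℝ n (fun q : (B →L[ℂ] D) × (A →L[ℂ] B) => q.1 ∘L q.2) :=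
  ContDiff.restrict_scalars ℝ (𝕜' := ℂ) (contDiff_fst.clm_comp contDiff_snd)

theorem contDiffAt_real_comp {X A B D : Type*} [NormedAddCommGroup X] [NormedSpace ℝ X]
    [NormedAddCommGroup A] [InnerProductSpace ℂ A]
    [NormedAddCommGroup B] [InnerProductSpace ℂ B] [NormedAddCommGroup D]
    [InnerProductSpace ℂ D] {n : ℕ∞ω} {f : X → (B →L[ℂ] D)} {h : X → (A →L[ℂ] B)} {x : X}
    (hf : ContDiffAt ℝ n f x) (hh : ContDiffAt ℝ n h x) :
    ContDiffAt ℝ n (fun T => f T ∘L h T) x :=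
  contDiff_real_comp.contDiffAt.comp x (hf.prodMk hh)

/-- The analytic square root near `1` in a Banach algebra. -/
theorem exists_analytic_sqrt (A : Type*) [NormedRing A] [NormedAlgebra ℂ A] [CompleteSpace A] :
    ∃ s : A → A, ContDiffAt ℂ ω s 1 ∧ s 1 = 1 ∧ (∀ᶠ a in 𝓝 (1 : A), s a * s a = a) ∧
      ∀ᶠ b in 𝓝 (1 : A), s (b * b) = b := by
  -- Squaring has derivative `2` at `1`, so the inverse function theorem applies.
  let f' : A ≃L[ℂ] A := ContinuousLinearEquiv.smulLeft (Units.mk0 (2 : ℂ) two_ne_zero)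
  have hc : ContDiffAt ℂ ω (fun b : A => b * b) 1 := by fun_prop
  have hd : HasFDerivAt (fun b : A => b * b) (f' : A →L[ℂ] A) 1 := by
    have h := (hasFDerivAt_id (𝕜 := ℂ) (1 : A)).mul' (hasFDerivAt_id (𝕜 := ℂ) (1 : A))
    refine h.congr_fderiv ?_
    ext x
    simp [f', two_smul]
  have hs := hc.hasStrictFDerivAt' hd (by simp)
  have h11 : (1 : A) * 1 = 1 := mul_one 1
  refine ⟨hc.localInverse hd (by simp), ?_, ?_, ?_, ?_⟩
  · have := hc.to_localInverse hd (by simp)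
    rwa [h11] at this
  · have := hc.localInverse_apply_image hd (by simp)
    rwa [h11] at this
  · have := hs.eventually_right_inverse
    rw [h11] at this
    exact this
  -- This uniqueness of square roots near `1` later makes the root of a self-adjoint element
  -- self-adjoint.
  · exact hs.eventually_left_inverse

variable {E : Type*} [NormedAddCommGroup E] [InnerProductSpace ℂ E] [CompleteSpace E]
  {C : Type*} [NormedAddCommGroup C] [InnerProductSpace ℂ C] [CompleteSpace C]

/-- An analytic family of frames of invariant subspaces, extending a spectral subspace. -/
theorem exists_analytic_frame {T₀ : E →L[ℂ] E} {r₀ : ℂ} {V₀ : C →L[ℂ] E}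
    (hV : ContinuousLinearMap.adjoint V₀ ∘L V₀ = ContinuousLinearMap.id ℂ C)
    (hTV : T₀ ∘L V₀ = r₀ • V₀) (hB : IsUnit (bordered T₀ r₀ V₀)) :
    ∃ (V : (E →L[ℂ] E) → (C →L[ℂ] E)) (L : (E →L[ℂ] E) → (C →L[ℂ] C)),
      ContDiffAt ℂ ω V T₀ ∧ ContDiffAt ℂ ω L T₀ ∧ V T₀ = V₀ ∧
      L T₀ = r₀ • ContinuousLinearMap.id ℂ C ∧ ∀ᶠ T in 𝓝 T₀, T ∘L V T = V T ∘L L T := by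
  -- The normalization `V₀† V = 1` removes the freedom of changing basis in the invariant subspace,
  -- so that `V` and `L` are both determined.
  set G : (E →L[ℂ] E) × ((C →L[ℂ] E) × (C →L[ℂ] C)) → (C →L[ℂ] E) × (C →L[ℂ] C) := fun q =>
    (q.1 ∘L q.2.1 - q.2.1 ∘L q.2.2, ContinuousLinearMap.adjoint V₀ ∘L q.2.1) with hG
  set u : (E →L[ℂ] E) × ((C →L[ℂ] E) × (C →L[ℂ] C)) :=
    (T₀, (V₀, r₀ • ContinuousLinearMap.id ℂ C)) with hu
  have hGc : ContDiffAt ℂ ω G u := by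
    have : ContDiff ℂ ω G :=
      ((contDiff_fst.clm_comp (contDiff_fst.comp contDiff_snd)).sub
        ((contDiff_fst.comp contDiff_snd).clm_comp (contDiff_snd.comp contDiff_snd))).prodMk
        (contDiff_const.clm_comp (contDiff_fst.comp contDiff_snd))
    exact this.contDiffAt
  have hGu : G u = (0, ContinuousLinearMap.id ℂ C) := by
    simp [hG, hu, hTV, hV]
  -- Evaluated at `c`, this derivative is the bordered operator at `(X c, Y c)`; inverting it
  -- amounts to composing with the inverse `N` of the bordered operator.
  have hd : ∀ X : C →L[ℂ] E, ∀ Y : C →L[ℂ] C, fderiv ℂ G u (0, (X, Y)) =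
      (T₀ ∘L X - r₀ • X - V₀ ∘L Y, ContinuousLinearMap.adjoint V₀ ∘L X) := by
    intro X Y
    have h1 : HasFDerivAt (fun q : (E →L[ℂ] E) × ((C →L[ℂ] E) × (C →L[ℂ] C)) => q.1)
      (ContinuousLinearMap.fst ℂ _ _) u := hasFDerivAt_fst
    have h2 : HasFDerivAt (fun q : (E →L[ℂ] E) × ((C →L[ℂ] E) × (C →L[ℂ] C)) => q.2.1)
      ((ContinuousLinearMap.fst ℂ _ _).comp (ContinuousLinearMap.snd ℂ _ _)) u :=
      hasFDerivAt_snd.fst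
    have h3 : HasFDerivAt (fun q : (E →L[ℂ] E) × ((C →L[ℂ] E) × (C →L[ℂ] C)) => q.2.2)
      ((ContinuousLinearMap.snd ℂ _ _).comp (ContinuousLinearMap.snd ℂ _ _)) u :=
      hasFDerivAt_snd.snd
    have h4 := ((h1.clm_comp h2).sub (h2.clm_comp h3)).prodMk
      ((hasFDerivAt_const (ContinuousLinearMap.adjoint V₀) u).clm_comp h2)
    rw [show fderiv ℂ G u = _ from h4.fderiv]
    ext x
    · simp [hu]
      abel
    · simp [hu]
  obtain ⟨N, hN1, hN2⟩ := isUnit_iff_exists.1 hB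
  have hbor : ∀ x, bordered T₀ r₀ V₀ (N x) = x := fun x => DFunLike.congr_fun hN1 x
  have hinv : (fderiv ℂ G u ∘L .inr ℂ (E →L[ℂ] E) ((C →L[ℂ] E) × (C →L[ℂ] C))).IsInvertible := by
    have hbij : Function.Bijective
        (fderiv ℂ G u ∘L .inr ℂ (E →L[ℂ] E) ((C →L[ℂ] E) × (C →L[ℂ] C))) := by
      constructor
      · rw [injective_iff_map_eq_zero]
        rintro ⟨X, Y⟩ h
        have h' := (hd X Y).symm.trans h
        rw [Prod.mk_eq_zero] at h'
        have hx : ∀ c, (X c, Y c) = (0 : E × C) := fun c => by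
          have : bordered T₀ r₀ V₀ (X c, Y c) = 0 := by
            rw [bordered_apply, Prod.mk_eq_zero]
            exact ⟨DFunLike.congr_fun h'.1 c, DFunLike.congr_fun h'.2 c⟩
          have h6 : N (bordered T₀ r₀ V₀ (X c, Y c)) = (X c, Y c) := DFunLike.congr_fun hN2 _
          rw [← h6, this, map_zero]
        rw [Prod.mk_eq_zero]
        exact ⟨ContinuousLinearMap.ext fun c => (Prod.mk_eq_zero.1 (hx c)).1,
          ContinuousLinearMap.ext fun c => (Prod.mk_eq_zero.1 (hx c)).2⟩
      · rintro ⟨X, Y⟩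
        refine ⟨(ContinuousLinearMap.fst ℂ E C ∘L N ∘L X.prod Y,
          ContinuousLinearMap.snd ℂ E C ∘L N ∘L X.prod Y), ?_⟩
        refine (hd _ _).trans ?_
        have hx : ∀ c, bordered T₀ r₀ V₀ (N (X c, Y c)) = (X c, Y c) := fun c => hbor _
        simp only [bordered_apply, Prod.mk.injEq] at hx
        rw [Prod.mk.injEq]
        exact ⟨ContinuousLinearMap.ext fun c => (hx c).1,
          ContinuousLinearMap.ext fun c => (hx c).2⟩
    exact ⟨ContinuousLinearEquiv.ofBijective _ (LinearMap.ker_eq_bot.2 hbij.1)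
      (LinearMap.range_eq_top.2 hbij.2), by ext x <;> rfl⟩
  have hψ := hGc.contDiffAt_implicitFunction (by simp) hinv
  have hψ0 := hGc.implicitFunction_apply_self (by simp) hinv
  have hψe := hGc.eventually_apply_implicitFunction (by simp) hinv
  set ψ := hGc.implicitFunction (by simp) hinv
  refine ⟨fun T => (ψ T).1, fun T => (ψ T).2, hψ.fst, hψ.snd, ?_, ?_, ?_⟩
  · exact congrArg Prod.fst hψ0
  · exact congrArg Prod.snd hψ0
  · filter_upwards [hψe] with T hT
    rw [hGu] at hT
    exact sub_eq_zero.1 (congrArg Prod.fst hT)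

/-- An analytic family of orthonormal frames of invariant subspaces. -/
theorem exists_analytic_orthonormal_frame {T₀ : E →L[ℂ] E} {r₀ : ℂ} {V₀ : C →L[ℂ] E}
    (hV : ContinuousLinearMap.adjoint V₀ ∘L V₀ = ContinuousLinearMap.id ℂ C)
    (hTV : T₀ ∘L V₀ = r₀ • V₀) (hB : IsUnit (bordered T₀ r₀ V₀)) :
    ∃ (W : (E →L[ℂ] E) → (C →L[ℂ] E)) (L : (E →L[ℂ] E) → (C →L[ℂ] C)),
      ContDiffAt ℝ ω W T₀ ∧ ContDiffAt ℝ ω L T₀ ∧ W T₀ = V₀ ∧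
      L T₀ = r₀ • ContinuousLinearMap.id ℂ C ∧ (∀ᶠ T in 𝓝 T₀, T ∘L W T = W T ∘L L T) ∧
      ∀ᶠ T in 𝓝 T₀, ContinuousLinearMap.adjoint (W T) ∘L W T = ContinuousLinearMap.id ℂ C := by
  obtain ⟨V, L, hVc, hLc, hV0, hL0, hVL⟩ := exists_analytic_frame hV hTV hB
  obtain ⟨s, hsc, hs1, hss, hsu⟩ := exists_analytic_sqrt (C →L[ℂ] C)
  -- Analyticity becomes real here: the adjoint in `V†V` is conjugate linear.
  replace hVc := hVc.restrict_scalars ℝ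
  replace hLc := hLc.restrict_scalars ℝ
  replace hsc := hsc.restrict_scalars ℝ
  set g : (E →L[ℂ] E) → (C →L[ℂ] C) := fun T => ContinuousLinearMap.adjoint (V T) ∘L V T with hg
  have hg0 : g T₀ = 1 := by simp only [hg, hV0, hV]; rfl
  have hgc : ContDiffAt ℝ ω g T₀ :=
    contDiffAt_real_comp ((adjointReal E C).contDiff.contDiffAt.comp T₀ hVc) hVc
  set b : (E →L[ℂ] E) → (C →L[ℂ] C) := fun T => s (g T) with hb
  have hb0 : b T₀ = 1 := by simp only [hb, hg0, hs1]
  have hbc : ContDiffAt ℝ ω b T₀ := ContDiffAt.comp T₀ (hg0 ▸ hsc) hgc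
  have hbi : ContDiffAt ℝ ω (fun T => Ring.inverse (b T)) T₀ := by
    have h0 : ContDiffAt ℝ ω (Ring.inverse : (C →L[ℂ] C) → (C →L[ℂ] C)) (b T₀) := by
      have := contDiffAt_ringInverse (n := ω) ℝ (1 : (C →L[ℂ] C)ˣ)
      rw [hb0]
      exact this
    exact h0.comp T₀ hbc
  refine ⟨fun T => V T ∘L Ring.inverse (b T), fun T => b T ∘L (L T ∘L Ring.inverse (b T)),
    contDiffAt_real_comp hVc hbi, contDiffAt_real_comp hbc (contDiffAt_real_comp hLc hbi), ?_, ?_, ?_, ?_⟩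
  · simp only [hb0, Ring.inverse_one, hV0]
    rfl
  · simp only [hb0, Ring.inverse_one, hL0]
    rfl
  · have hunit : ∀ᶠ T in 𝓝 T₀, IsUnit (b T) :=
      hbc.continuousAt.eventually (by rw [hb0]; exact Units.isOpen.mem_nhds isUnit_one)
    filter_upwards [hVL, hunit] with T h1 h2
    rw [← ContinuousLinearMap.comp_assoc, h1]
    have h3 : Ring.inverse (b T) ∘L b T = ContinuousLinearMap.id ℂ C :=
      Ring.inverse_mul_cancel _ h2
    calc (V T ∘L L T) ∘L Ring.inverse (b T)
        = V T ∘L (ContinuousLinearMap.id ℂ C ∘L (L T ∘L Ring.inverse (b T))) := rfl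
      _ = _ := by rw [← h3]; rfl
  · have hunit : ∀ᶠ T in 𝓝 T₀, IsUnit (b T) :=
      hbc.continuousAt.eventually (by rw [hb0]; exact Units.isOpen.mem_nhds isUnit_one)
    have hsq : ∀ᶠ T in 𝓝 T₀, b T * b T = g T :=
      hgc.continuousAt.eventually (by rw [hg0]; exact hss)
    have hadj : Tendsto (fun T => ContinuousLinearMap.adjoint (b T)) (𝓝 T₀) (𝓝 1) := by
      have h := ((adjointReal C C).continuous.tendsto (b T₀)).comp hbc.continuousAt
      rw [hb0] at h
      have hadj1 : adjointReal C C 1 = 1 := star_one (C →L[ℂ] C)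
      rwa [hadj1] at h
    have hun : ∀ᶠ T in 𝓝 T₀, s (ContinuousLinearMap.adjoint (b T) *
        ContinuousLinearMap.adjoint (b T)) = ContinuousLinearMap.adjoint (b T) :=
      hadj.eventually hsu
    filter_upwards [hunit, hsq, hun] with T h1 h2 h3
    -- Both `b` and its adjoint are close to `1` and have square `g`, which is self-adjoint;
    -- uniqueness of the root near `1` identifies them.
    have h4 : ContinuousLinearMap.adjoint (b T) = b T := by
      have h5 : ContinuousLinearMap.adjoint (b T) * ContinuousLinearMap.adjoint (b T) = g T := by
        have h6 : star (b T * b T) = star (g T) := by rw [h2]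
        rw [star_mul] at h6
        refine Eq.trans h6 ?_
        simp only [hg, ContinuousLinearMap.star_eq_adjoint, ContinuousLinearMap.adjoint_comp,
          ContinuousLinearMap.adjoint_adjoint]
      rw [h5] at h3
      exact h3.symm
    have h7 : ContinuousLinearMap.adjoint (Ring.inverse (b T)) = Ring.inverse (b T) := by
      obtain ⟨v, hv⟩ := h1
      rw [← hv, Ring.inverse_unit]
      have h8 : star v = v := Units.ext (by rw [Units.coe_star, hv]; exact h4)
      have h9 : star v⁻¹ = v⁻¹ := by rw [star_inv, h8]
      exact congrArg Units.val h9
    rw [ContinuousLinearMap.adjoint_comp, h7]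
    calc _ = Ring.inverse (b T) * (g T) * Ring.inverse (b T) := rfl
      _ = (Ring.inverse (b T) * b T) * (b T * Ring.inverse (b T)) := by
        rw [← h2]; simp only [mul_assoc]
      _ = 1 := by rw [Ring.inverse_mul_cancel _ h1, Ring.mul_inverse_cancel _ h1, one_mul]

end AnalyticFrame

/-! ### Spectral data of the unbounded operator read off from its resolvent at `-i`. -/

section Resolvent

variable {E : Type*} [NormedAddCommGroup E] [InnerProductSpace ℂ E] {A : E →ₗ.[ℂ] E}

theorem mem_eigenspace_iff {l : ℝ} {v : E} :
    v ∈ eigenspace A l ↔ ∃ h : v ∈ A.domain, A ⟨v, h⟩ = (l : ℂ) • v := by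
  constructor
  · rintro ⟨u, hu, rfl⟩
    refine ⟨u.2, ?_⟩
    have h : A.toFun u - (l : ℂ) • (u : E) = 0 := hu
    exact sub_eq_zero.1 h
  · rintro ⟨h, hv⟩
    refine ⟨⟨v, h⟩, ?_, rfl⟩
    have : A.toFun ⟨v, h⟩ - (l : ℂ) • v = 0 := sub_eq_zero.2 hv
    exact this

theorem _root_.IsSelfAdjoint.linearPMap_inner [CompleteSpace E] (hA : IsSelfAdjoint A)
    (u v : A.domain) : inner ℂ (A u) (v : E) = inner ℂ (u : E) (A v) := by
  have h := LinearPMap.adjoint_isFormalAdjoint hA.dense_domain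
  rw [LinearPMap.isSelfAdjoint_def.1 hA] at h
  exact h u v

theorem eq_zero_of_mem_eigenspace {l : ℝ} (hl : l ∉ realSpectrum A) {v : E}
    (hv : v ∈ eigenspace A l) : v = 0 := by
  obtain ⟨Q, -, hQ⟩ := not_not.1 hl
  obtain ⟨h, hv⟩ := mem_eigenspace_iff.1 hv
  have := hQ ⟨v, h⟩
  rw [hv, sub_self, map_zero] at this
  exact this.symm

theorem eq_zero_of_mem_eigenspace_of_ne {l l' : ℝ} (hl : l ≠ l') {v : E}
    (hv : v ∈ eigenspace A l) (hv' : v ∈ eigenspace A l') : v = 0 := by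
  obtain ⟨h, hv⟩ := mem_eigenspace_iff.1 hv
  obtain ⟨h', hv'⟩ := mem_eigenspace_iff.1 hv'
  have : ((l : ℂ) - l') • v = 0 := by rw [sub_smul, ← hv, ← hv', sub_self]
  exact (smul_eq_zero.1 this).resolve_left (sub_ne_zero.2 (by exact_mod_cast hl))

theorem ofReal_add_I_ne_zero (l : ℝ) : (l : ℂ) + Complex.I ≠ 0 := by
  intro h
  simpa using congrArg Complex.im h

variable {R : E →L[ℂ] E}

theorem IsResolvent.apply_eq (hR : IsResolvent A (-Complex.I) R) (v : E) :
    ∃ h : R v ∈ A.domain, A ⟨R v, h⟩ = v - Complex.I • R v := by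
  obtain ⟨h, hv⟩ := hR.1 v
  refine ⟨h, ?_⟩
  nth_rw 2 [← hv]
  module

theorem IsResolvent.mem_eigenspace_iff (hR : IsResolvent A (-Complex.I) R) {l : ℝ} {v : E} :
    v ∈ eigenspace A l ↔ R v = ((l : ℂ) + Complex.I)⁻¹ • v := by
  rw [FiberedOperator.mem_eigenspace_iff, eq_inv_smul_iff₀ (ofReal_add_I_ne_zero l)]
  constructor
  · rintro ⟨h, hv⟩
    have := hR.2 ⟨v, h⟩
    rw [hv, neg_smul, sub_neg_eq_add, ← add_smul, map_smul] at this
    exact this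
  · intro h
    rw [← map_smul] at h
    obtain ⟨h1, h2⟩ := hR.apply_eq (((l : ℂ) + Complex.I) • v)
    simp only [h] at h1 h2
    refine ⟨h1, h2.trans ?_⟩
    module

/-- The vector `v` is arbitrary: this is the dual eigenvector relation required by
`bordered_injective`, and it uses the symmetry of `A`. -/
theorem IsResolvent.inner_eigenspace [CompleteSpace E] (hA : IsSelfAdjoint A)
    (hR : IsResolvent A (-Complex.I) R) {l : ℝ} {u : E} (hu : u ∈ eigenspace A l) (v : E) :
    inner ℂ u (R v) = ((l : ℂ) + Complex.I)⁻¹ * inner ℂ u v := by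
  obtain ⟨h1, h2⟩ := hR.apply_eq v
  obtain ⟨h3, h4⟩ := FiberedOperator.mem_eigenspace_iff.1 hu
  have h5 := hA.linearPMap_inner ⟨u, h3⟩ ⟨R v, h1⟩
  rw [h4, h2, inner_smul_left, inner_sub_right, inner_smul_right, Complex.conj_ofReal] at h5
  rw [eq_inv_mul_iff_mul_eq₀ (ofReal_add_I_ne_zero l)]
  linear_combination h5

/-- With `r = (l + i)⁻¹`, if `r` is not an eigenvalue of the compact `R` then `r - R` has an inverse
`N`, and `r R N` is a bounded inverse of `A - l`. -/
theorem IsResolvent.exists_eigenvector [CompleteSpace E] (hR : IsResolvent A (-Complex.I) R)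
    (hRc : IsCompactOperator R) {l : ℝ} (hl : l ∈ realSpectrum A) :
    ∃ v ∈ eigenspace A l, v ≠ 0 := by
  by_contra! H
  have hr : ((l : ℂ) + Complex.I)⁻¹ ≠ 0 := inv_ne_zero (ofReal_add_I_ne_zero l)
  rcases hRc.hasEigenvalue_or_mem_resolventSet hr with h | h
  · obtain ⟨v, hv⟩ := h.exists_hasEigenvector
    exact hv.2 (H v (hR.mem_eigenspace_iff.2 hv.apply_eq_smul))
  · rw [spectrum.mem_resolventSet_iff] at h
    obtain ⟨N, hN1, hN2⟩ := isUnit_iff_exists.1 h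
    set r := ((l : ℂ) + Complex.I)⁻¹ with hrdef
    have hN1' : ∀ v, r • N v - R (N v) = v := fun v => by
      have := DFunLike.congr_fun hN1 v
      rw [Algebra.algebraMap_eq_smul_one] at this
      exact this
    have hN2' : ∀ v, N (r • v - R v) = v := fun v => by
      have := DFunLike.congr_fun hN2 v
      rw [Algebra.algebraMap_eq_smul_one] at this
      exact this
    have hcomm : ∀ v, R (N v) = N (R v) := fun v => by
      have h1 : R (N v) = r • N v - v := by rw [eq_sub_iff_add_eq, ← eq_sub_iff_add_eq']
                                            exact (hN1' v).symm
      have h2 := hN2' v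
      rw [map_sub, map_smul] at h2
      rw [h1]
      nth_rw 2 [← h2]
      abel
    refine hl ⟨r • R ∘L N, ?_, ?_⟩
    · intro v
      obtain ⟨h1, h2⟩ := hR.apply_eq (r • N v)
      have h3 : (r • R ∘L N) v = R (r • N v) := by simp
      simp only [h3]
      refine ⟨h1, ?_⟩
      rw [h2]
      nth_rw 4 [← hN1' v]
      have h4 : ((l : ℂ) + Complex.I) • R (r • N v) = R (N v) := by
        rw [map_smul, smul_smul, hrdef, mul_inv_cancel₀ (ofReal_add_I_ne_zero l), one_smul]
      rw [← h4]
      module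
    · intro u
      have h1 := hR.2 u
      have h3 : (r • R ∘L N) (A u - (l : ℂ) • (u : E)) = r • R (N (A u - (l : ℂ) • (u : E))) := by
        simp
      rw [h3, hcomm]
      have h2 : A u - (l : ℂ) • (u : E) =
          (A u - (-Complex.I) • (u : E)) - ((l : ℂ) + Complex.I) • (u : E) := by module
      rw [h2, map_sub, h1, map_smul, ← map_smul, smul_sub, smul_smul, hrdef,
        inv_mul_cancel₀ (ofReal_add_I_ne_zero l), one_smul]
      exact hN2' u

end Resolvent

/-! ### Operators restricted to the range of an intertwining isometry. -/

section Compression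

variable {E : Type*} [NormedAddCommGroup E] [InnerProductSpace ℂ E] [CompleteSpace E]
  {A : E →ₗ.[ℂ] E} {C : Type*} [NormedAddCommGroup C] [InnerProductSpace ℂ C] [CompleteSpace C]
  {W : C →L[ℂ] E} {h : C →L[ℂ] C}

theorem inner_map_of_adjoint_comp (hW : ContinuousLinearMap.adjoint W ∘L W =
    ContinuousLinearMap.id ℂ C) (a b : C) : inner ℂ (W a) (W b) = inner ℂ a b := by
  rw [← ContinuousLinearMap.adjoint_inner_right, ← ContinuousLinearMap.comp_apply, hW]
  rfl

theorem adjoint_apply_apply (hW : ContinuousLinearMap.adjoint W ∘L W =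
    ContinuousLinearMap.id ℂ C) (a : C) : ContinuousLinearMap.adjoint W (W a) = a :=
  DFunLike.congr_fun hW a

theorem norm_map_of_adjoint_comp (hW : ContinuousLinearMap.adjoint W ∘L W =
    ContinuousLinearMap.id ℂ C) (a : C) : ‖W a‖ = ‖a‖ := by
  have := inner_map_of_adjoint_comp hW a a
  rw [inner_self_eq_norm_sq_to_K, inner_self_eq_norm_sq_to_K] at this
  have h2 : ‖W a‖ ^ 2 = ‖a‖ ^ 2 := by exact_mod_cast this
  exact (sq_eq_sq₀ (norm_nonneg _) (norm_nonneg _)).1 h2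

/-- `W` intertwines the bounded operator `h` with the operator `A`. -/
def Intertwines (A : E →ₗ.[ℂ] E) (W : C →L[ℂ] E) (h : C →L[ℂ] C) : Prop :=
  ∀ c, ∃ hc : W c ∈ A.domain, A ⟨W c, hc⟩ = W (h c)

theorem Intertwines.symmetric (hi : Intertwines A W h) (hA : IsSelfAdjoint A)
    (hW : ContinuousLinearMap.adjoint W ∘L W = ContinuousLinearMap.id ℂ C) (a b : C) :
    inner ℂ (h a) b = inner ℂ a (h b) := by
  obtain ⟨h1, h2⟩ := hi a
  obtain ⟨h3, h4⟩ := hi b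
  rw [← inner_map_of_adjoint_comp hW, ← inner_map_of_adjoint_comp hW a, ← h2, ← h4]
  exact hA.linearPMap_inner ⟨W a, h1⟩ ⟨W b, h3⟩

theorem Intertwines.apply_adjoint (hi : Intertwines A W h) (hA : IsSelfAdjoint A)
    (hW : ContinuousLinearMap.adjoint W ∘L W = ContinuousLinearMap.id ℂ C) {l : ℝ} {v : E}
    (hv : v ∈ eigenspace A l) :
    h (ContinuousLinearMap.adjoint W v) = (l : ℂ) • ContinuousLinearMap.adjoint W v := by
  refine ext_inner_right ℂ fun c => ?_
  obtain ⟨h1, h2⟩ := mem_eigenspace_iff.1 hv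
  obtain ⟨h3, h4⟩ := hi c
  rw [hi.symmetric hA hW, ContinuousLinearMap.adjoint_inner_left, ← h4,
    ← hA.linearPMap_inner ⟨v, h1⟩ ⟨W c, h3⟩, h2, inner_smul_left, inner_smul_left,
    ContinuousLinearMap.adjoint_inner_left]

theorem Intertwines.mem_eigenspace (hi : Intertwines A W h) {l : ℝ} {c : C}
    (hc : h c = (l : ℂ) • c) : W c ∈ eigenspace A l := by
  obtain ⟨h1, h2⟩ := hi c
  exact mem_eigenspace_iff.2 ⟨h1, by rw [h2, hc, map_smul]⟩

/-- The range of `W` reduces `A`, so the part of an eigenvector orthogonal to it is again in the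
eigenspace. The bordered operator will force that part to vanish. -/
theorem Intertwines.sub_mem_eigenspace (hi : Intertwines A W h) (hA : IsSelfAdjoint A)
    (hW : ContinuousLinearMap.adjoint W ∘L W = ContinuousLinearMap.id ℂ C) {l : ℝ} {v : E}
    (hv : v ∈ eigenspace A l) : v - W (ContinuousLinearMap.adjoint W v) ∈ eigenspace A l :=
  Submodule.sub_mem _ hv (hi.mem_eigenspace (hi.apply_adjoint hA hW hv))

/-- The symmetric matrix `h` is diagonalizable, and its eigenvalues lie within `ε` of `l₀`, hence in
`J`. So `W` sends an eigenbasis to eigenvectors with energies in `J`. -/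
theorem Intertwines.iSup_eigenspace [FiniteDimensional ℂ C] (hi : Intertwines A W h)
    (hA : IsSelfAdjoint A)
    (hW : ContinuousLinearMap.adjoint W ∘L W = ContinuousLinearMap.id ℂ C) {J : Set ℝ}
    (hJ : ∀ l ∈ J, eigenspace A l ≤ LinearMap.range (W : C →ₗ[ℂ] E)) {l₀ ε : ℝ}
    (hε : ‖h - (l₀ : ℂ) • ContinuousLinearMap.id ℂ C‖ < ε) (hJε : Metric.ball l₀ ε ⊆ J) :
    ⨆ l ∈ J, eigenspace A l = LinearMap.range (W : C →ₗ[ℂ] E) := by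
  refine le_antisymm (iSup₂_le hJ) ?_
  rintro _ ⟨c, rfl⟩
  have hs : (h : C →ₗ[ℂ] C).IsSymmetric := hi.symmetric hA hW
  set b := hs.eigenvectorBasis rfl
  rw [← b.sum_repr c, map_sum]
  refine Submodule.sum_mem _ fun i _ => ?_
  rw [map_smul]
  refine Submodule.smul_mem _ _ ?_
  have h1 : h (b i) = ((hs.eigenvalues rfl i : ℝ) : ℂ) • b i := hs.apply_eigenvectorBasis rfl i
  have h2 : hs.eigenvalues rfl i ∈ J := by
    refine hJε ?_
    rw [mem_ball_iff_norm]
    refine lt_of_le_of_lt ?_ hε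
    have h3 := (h - (l₀ : ℂ) • ContinuousLinearMap.id ℂ C).le_opNorm (b i)
    have h4 : (h - (l₀ : ℂ) • ContinuousLinearMap.id ℂ C) (b i) =
        ((hs.eigenvalues rfl i - l₀ : ℝ) : ℂ) • b i := by
      simp [h1, sub_smul]
    rw [h4, norm_smul, b.norm_eq_one, mul_one, mul_one, Complex.norm_real] at h3
    exact h3
  exact (le_iSup₂ (f := fun l (_ : l ∈ J) => eigenspace A l) _ h2) (hi.mem_eigenspace h1)

theorem spectralProj_eq_of_iSup [FiniteDimensional ℂ C]
    (hW : ContinuousLinearMap.adjoint W ∘L W = ContinuousLinearMap.id ℂ C) {J : Set ℝ}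
    (hJ : ⨆ l ∈ J, eigenspace A l = LinearMap.range (W : C →ₗ[ℂ] E)) :
    spectralProj A J = W ∘L ContinuousLinearMap.adjoint W := by
  have hcl : (⨆ l ∈ J, eigenspace A l).topologicalClosure = LinearMap.range (W : C →ₗ[ℂ] E) := by
    rw [hJ]
    exact (Submodule.closed_of_finiteDimensional _).submodule_topologicalClosure_eq
  ext v
  refine Submodule.eq_starProjection_of_mem_of_inner_eq_zero ?_ ?_
  · rw [hcl]
    exact ⟨_, rfl⟩
  · rw [hcl]
    rintro _ ⟨c, rfl⟩
    have : inner ℂ (W (ContinuousLinearMap.adjoint W v)) (W c) = inner ℂ v (W c) := by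
      rw [inner_map_of_adjoint_comp hW, ContinuousLinearMap.adjoint_inner_left]
    rw [inner_sub_left]
    exact sub_eq_zero.2 this.symm

/-- Energies outside the spectrum have trivial eigenspaces and do not contribute. -/
theorem spectralProj_congr {J J' : Set ℝ} (hJ : J' ⊆ J)
    (h : ∀ l ∈ J, l ∈ realSpectrum A → l ∈ J') : spectralProj A J = spectralProj A J' := by
  have : ⨆ l ∈ J, eigenspace A l = ⨆ l ∈ J', eigenspace A l := by
    refine le_antisymm (iSup₂_le fun l hl => ?_) (biSup_mono hJ)
    by_cases hs : l ∈ realSpectrum A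
    · exact le_iSup₂ (f := fun l (_ : l ∈ J') => eigenspace A l) l (h l hl hs)
    · intro v hv
      rw [eq_zero_of_mem_eigenspace hs hv]
      exact Submodule.zero_mem _
  unfold spectralProj
  simp only [this]

theorem spectralProj_comp {J J' : Set ℝ} (hJ : J' ⊆ J) :
    spectralProj A J ∘L spectralProj A J' = spectralProj A J' := by
  have hle : (⨆ l ∈ J', eigenspace A l).topologicalClosure ≤
      (⨆ l ∈ J, eigenspace A l).topologicalClosure :=
    Submodule.topologicalClosure_mono (biSup_mono hJ)
  ext v
  exact Submodule.starProjection_eq_self_iff.2 (hle (Submodule.starProjection_apply_mem _ v))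

end Compression

theorem adjoint_comp_of_inner {E C : Type*} [NormedAddCommGroup E] [InnerProductSpace ℂ E]
    [CompleteSpace E] [NormedAddCommGroup C] [InnerProductSpace ℂ C] [CompleteSpace C]
    {W : C →L[ℂ] E} (h : ∀ a b, inner ℂ (W a) (W b) = inner ℂ a b) :
    ContinuousLinearMap.adjoint W ∘L W = ContinuousLinearMap.id ℂ C := by
  ext a
  refine ext_inner_right ℂ fun b => ?_
  rw [ContinuousLinearMap.comp_apply, ContinuousLinearMap.adjoint_inner_left, h]
  rfl

/-! ### The analytic matrix of the operator in the analytic frame. -/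

section Compression

variable {E : Type*} [NormedAddCommGroup E] [InnerProductSpace ℂ E] [CompleteSpace E]
  {C : Type*} [NormedAddCommGroup C] [InnerProductSpace ℂ C] [CompleteSpace C]

/-- Invertibility is open jointly in the operator and the energy, so one `δ` serves all `T` near
`T₀`. -/
theorem eventually_isUnit_bordered {T₀ : E →L[ℂ] E} {l₀ : ℝ} {W : (E →L[ℂ] E) → (C →L[ℂ] E)}
    (hWc : ContinuousAt W T₀) (hB : IsUnit (bordered T₀ ((l₀ : ℂ) + Complex.I)⁻¹ (W T₀))) :
    ∃ δ > 0, ∀ᶠ T in 𝓝 T₀, ∀ l : ℝ, |l - l₀| < δ →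
      IsUnit (bordered T ((l : ℂ) + Complex.I)⁻¹ (W T)) := by
  set r : ℝ → ℂ := fun l => ((l : ℂ) + Complex.I)⁻¹ with hr
  have hrc : Continuous r :=
    (Complex.continuous_ofReal.add continuous_const).inv₀ ofReal_add_I_ne_zero
  have h1 : Tendsto (fun p : (E →L[ℂ] E) × ℝ => (p.1, r p.2, W p.1)) (𝓝 T₀ ×ˢ 𝓝 l₀)
      (𝓝 (T₀, r l₀, W T₀)) :=
    tendsto_fst.prodMk_nhds (((hrc.tendsto l₀).comp tendsto_snd).prodMk_nhds
      (hWc.tendsto.comp tendsto_fst))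
  have h2 := ((continuous_bordered (E := E) (C := C)).tendsto (T₀, r l₀, W T₀)).comp h1
  have hB' : ∀ᶠ B in 𝓝 (bordered T₀ (r l₀) (W T₀)), IsUnit B :=
    (Units.isOpen (R := (E × C) →L[ℂ] (E × C))).mem_nhds (by exact hB)
  have h3 := h2.eventually hB'
  obtain ⟨pT, hpT, pl, hpl, hbor⟩ := eventually_prod_iff.1 h3
  obtain ⟨δ, hδ, hpl⟩ := Metric.eventually_nhds_iff.1 hpl
  refine ⟨δ, hδ, hpT.mono fun T hT l hl => ?_⟩
  exact hbor hT (hpl (by rwa [Real.dist_eq]))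

/-- Analytic frames `W T` and analytic matrices `g T` such that an operator with resolvent `T` at
`-i` acts as `g T` in the frame `W T`. -/
theorem exists_analytic_compression [FiniteDimensional ℂ C] {T₀ : E →L[ℂ] E} {l₀ : ℝ}
    {V : C →L[ℂ] E} (hTc : IsCompactOperator T₀)
    (hV : ContinuousLinearMap.adjoint V ∘L V = ContinuousLinearMap.id ℂ C)
    (hTV : T₀ ∘L V = ((l₀ : ℂ) + Complex.I)⁻¹ • V)
    (hT : ∀ c v, inner ℂ (V c) (T₀ v) = ((l₀ : ℂ) + Complex.I)⁻¹ * inner ℂ (V c) v)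
    (hr : ∀ v, T₀ v = ((l₀ : ℂ) + Complex.I)⁻¹ • v → v ∈ range V) :
    ∃ (W : (E →L[ℂ] E) → (C →L[ℂ] E)) (g : (E →L[ℂ] E) → (C →L[ℂ] C)) (δ : ℝ), 0 < δ ∧
      g T₀ = (l₀ : ℂ) • ContinuousLinearMap.id ℂ C ∧
      ∀ᶠ T in 𝓝 T₀, (ContDiffAt ℝ ω W T ∧ ContDiffAt ℝ ω g T) ∧
        ContinuousLinearMap.adjoint (W T) ∘L W T = ContinuousLinearMap.id ℂ C ∧
        (∃ N : C →L[ℂ] C, (∀ c, T (W T (N c)) = W T c) ∧ ∀ c, g T c = N c - Complex.I • c) ∧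
        ∀ l : ℝ, |l - l₀| < δ → Function.Injective (bordered T ((l : ℂ) + Complex.I)⁻¹ (W T)) := by
  have hrne : ((l₀ : ℂ) + Complex.I)⁻¹ ≠ 0 := inv_ne_zero (ofReal_add_I_ne_zero l₀)
  have hB := isUnit_bordered hTc hrne (bordered_injective hV hT hr)
  obtain ⟨W, L, hWc, hLc, hW0, hL0, hWL, hWi⟩ := exists_analytic_orthonormal_frame hV hTV hB
  have hLN : L T₀ * (((l₀ : ℂ) + Complex.I) • (1 : C →L[ℂ] C)) = 1 ∧
      (((l₀ : ℂ) + Complex.I) • (1 : C →L[ℂ] C)) * L T₀ = 1 := by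
    have h1 : L T₀ = ((l₀ : ℂ) + Complex.I)⁻¹ • (1 : C →L[ℂ] C) := hL0
    rw [h1, smul_mul_smul_comm, smul_mul_smul_comm, mul_inv_cancel₀ (ofReal_add_I_ne_zero l₀),
      inv_mul_cancel₀ (ofReal_add_I_ne_zero l₀), one_smul, mul_one]
    exact ⟨rfl, rfl⟩
  set u : (C →L[ℂ] C)ˣ := ⟨L T₀, _, hLN.1, hLN.2⟩ with hu
  have huL : (u : C →L[ℂ] C) = L T₀ := rfl
  have hinvc : ContDiffAt ℝ ω (fun S => Ring.inverse (L S)) T₀ :=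
    ContDiffAt.comp (g := Ring.inverse) T₀ (huL ▸ contDiffAt_ringInverse (n := ω) ℝ u) hLc
  -- If the resolvent at `-i` acts as `L` in the frame, the operator itself acts as `L⁻¹ - i`.
  have hgc : ContDiffAt ℝ ω (fun S =>
      Ring.inverse (L S) - Complex.I • ContinuousLinearMap.id ℂ C) T₀ :=
    hinvc.sub contDiffAt_const
  obtain ⟨δ, hδ, hbor⟩ := eventually_isUnit_bordered hWc.continuousAt (by rwa [hW0])
  refine ⟨W, fun S => Ring.inverse (L S) - Complex.I • ContinuousLinearMap.id ℂ C, δ, hδ, ?_, ?_⟩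
  · simp only [← huL, Ring.inverse_unit]
    change ((l₀ : ℂ) + Complex.I) • ContinuousLinearMap.id ℂ C - _ = _
    module
  · have hLu : ∀ᶠ S in 𝓝 T₀, IsUnit (L S) :=
      hLc.continuousAt.eventually (Units.isOpen.mem_nhds u.isUnit)
    filter_upwards [hWc.eventually (by simp), hgc.eventually (by simp), hWi, hWL, hLu, hbor]
      with T h1 h2 h3 h4 h5 h6
    refine ⟨⟨h1, h2⟩, h3, ⟨Ring.inverse (L T), fun c => ?_, fun c => rfl⟩, fun l hl =>
      (ContinuousLinearMap.isUnit_iff_bijective.1 (h6 l hl)).1⟩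
    have h7 : T (W T (Ring.inverse (L T) c)) = W T (L T (Ring.inverse (L T) c)) :=
      DFunLike.congr_fun h4 _
    rw [h7]
    congr 1
    exact DFunLike.congr_fun (Ring.mul_inverse_cancel _ h5) c

end Compression

/-! ### Local analytic frames in the Hilbert bundle. -/

section LocalFrame

variable {d : ℕ} {M : Type*} [TopologicalSpace M] [ChartedSpace (EuclideanSpace ℝ (Fin d)) M]

theorem contMDiffOn_real_comp {A B D : Type*} [NormedAddCommGroup A] [InnerProductSpace ℂ A]
    [NormedAddCommGroup B] [InnerProductSpace ℂ B] [NormedAddCommGroup D]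
    [InnerProductSpace ℂ D] {n : ℕ∞ω} {f : M → (B →L[ℂ] D)} {h : M → (A →L[ℂ] B)} {s : Set M}
    (hf : ContMDiffOn (𝓡 d) 𝓘(ℝ, B →L[ℂ] D) n f s)
    (hh : ContMDiffOn (𝓡 d) 𝓘(ℝ, A →L[ℂ] B) n h s) :
    ContMDiffOn (𝓡 d) 𝓘(ℝ, A →L[ℂ] D) n (fun k => f k ∘L h k) s :=
  (contDiff_real_comp.contMDiff.comp_contMDiffOn (hf.prodMk_space hh))

variable {F : M → Type*} [∀ k, NormedAddCommGroup (F k)] [∀ k, InnerProductSpace ℂ (F k)]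
  [∀ k, CompleteSpace (F k)]
  {H' : Type*} [NormedAddCommGroup H'] [InnerProductSpace ℂ H']

/-- Over the open set `w`, the isometries `W k` are an analytic frame of a bundle of subspaces in
which `H₀` acts through the analytic matrix `h`, and which contains all the eigenvectors of `H₀`
with energies at distance less than `δ` from `l₀`. -/
structure IsLocalFrame (𝒜 : HilbertBundleAtlas d F H') (H₀ : ∀ k, F k →ₗ.[ℂ] F k) (w : Set M)
    (l₀ δ : ℝ) {μ : ℕ} (W : ∀ k, EuclideanSpace ℂ (Fin μ) →L[ℂ] F k)
    (h : M → (EuclideanSpace ℂ (Fin μ) →L[ℂ] EuclideanSpace ℂ (Fin μ))) : Prop where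
  isOpen : IsOpen w
  analytic_frame : 𝒜.IsAnalyticHom w W
  analytic_matrix : ContMDiffOn (𝓡 d) 𝓘(ℝ, EuclideanSpace ℂ (Fin μ) →L[ℂ]
    EuclideanSpace ℂ (Fin μ)) ω h w
  isometry : ∀ k ∈ w, ContinuousLinearMap.adjoint (W k) ∘L W k = ContinuousLinearMap.id ℂ _
  intertwines : ∀ k ∈ w, Intertwines (H₀ k) (W k) (h k)
  eigenspace_le : ∀ k ∈ w, ∀ l : ℝ, |l - l₀| < δ →
    eigenspace (H₀ k) l ≤ LinearMap.range (W k : EuclideanSpace ℂ (Fin μ) →ₗ[ℂ] F k)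

theorem IsLocalFrame.mono {𝒜 : HilbertBundleAtlas d F H'} {H₀ : ∀ k, F k →ₗ.[ℂ] F k} {w w' : Set M}
    {l₀ δ : ℝ} {μ : ℕ} {W : ∀ k, EuclideanSpace ℂ (Fin μ) →L[ℂ] F k}
    {h : M → (EuclideanSpace ℂ (Fin μ) →L[ℂ] EuclideanSpace ℂ (Fin μ))}
    (hw : IsLocalFrame 𝒜 H₀ w l₀ δ W h) (ho : IsOpen w') (hww : w' ⊆ w) :
    IsLocalFrame 𝒜 H₀ w' l₀ δ W h where
  isOpen := ho
  analytic_frame e he := (hw.analytic_frame e he).mono (inter_subset_inter_left _ hww)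
  analytic_matrix := hw.analytic_matrix.mono hww
  isometry k hk := hw.isometry k (hww hk)
  intertwines k hk := hw.intertwines k (hww hk)
  eigenspace_le k hk := hw.eigenspace_le k (hww hk)

/-- A finite-dimensional subspace is the range of an isometry. -/
theorem exists_isometry_range {E : Type*} [NormedAddCommGroup E] [InnerProductSpace ℂ E]
    {S : Submodule ℂ E} {μ : ℕ} (hS : Module.rank ℂ S = μ) :
    ∃ V : EuclideanSpace ℂ (Fin μ) →L[ℂ] E, (∀ a b, inner ℂ (V a) (V b) = inner ℂ a b) ∧
      LinearMap.range (V : EuclideanSpace ℂ (Fin μ) →ₗ[ℂ] E) = S := by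
  have hfin : FiniteDimensional ℂ S := by
    refine Module.rank_lt_aleph0_iff.1 ?_
    rw [hS]
    exact Cardinal.natCast_lt_aleph0
  have hr : Module.finrank ℂ S = μ := Module.finrank_eq_of_rank_eq hS
  let b := (stdOrthonormalBasis ℂ S).reindex (finCongr hr)
  refine ⟨S.subtypeL ∘L (b.repr.symm.toContinuousLinearEquiv : _ →L[ℂ] S), fun x y => ?_, ?_⟩
  · exact b.repr.symm.inner_map_map x y
  · ext v
    constructor
    · rintro ⟨c, rfl⟩
      exact (b.repr.symm c).2
    · intro hv
      refine ⟨b.repr ⟨v, hv⟩, ?_⟩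
      change ((b.repr.symm (b.repr ⟨v, hv⟩) : S) : E) = v
      rw [LinearIsometryEquiv.symm_apply_apply]

/-- One unitary trivialization turns the resolvents into an analytic family `T k` on the fixed space
`H'`, to which `exists_analytic_compression` applies; analytic transition functions handle the other
trivializations. An eigenvector with energy near `l₀`, minus its projection to the frame, gives an
element of the kernel of an injective bordered operator, hence lies in the frame. -/
theorem exists_isLocalFrame [CompleteSpace H'] {𝒜 : HilbertBundleAtlas d F H'}
    {H₀ : ∀ k, F k →ₗ.[ℂ] F k}
    (hH₀ : IsAnalyticallyFibered 𝒜 H₀) (k₀ : M) (l₀ : ℝ) {μ : ℕ}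
    (hμ : Module.rank ℂ (eigenspace (H₀ k₀) l₀) = μ) :
    ∃ (w : Set M) (W : ∀ k, EuclideanSpace ℂ (Fin μ) →L[ℂ] F k)
      (h : M → (EuclideanSpace ℂ (Fin μ) →L[ℂ] EuclideanSpace ℂ (Fin μ))) (δ : ℝ),
      0 < δ ∧ k₀ ∈ w ∧ IsLocalFrame 𝒜 H₀ w l₀ δ W h ∧
      h k₀ = (l₀ : ℂ) • ContinuousLinearMap.id ℂ _ := by
  obtain ⟨R, hR, hRc, hRa⟩ := hH₀.resolvent
  obtain ⟨e, he, hk₀⟩ := 𝒜.cover k₀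
  obtain ⟨V₀, hV₀, hV₀r⟩ := exists_isometry_range hμ
  set C := EuclideanSpace ℂ (Fin μ)
  set r : ℝ → ℂ := fun l => ((l : ℂ) + Complex.I)⁻¹ with hr
  set T : M → (H' →L[ℂ] H') := fun k => ((e.map k).toContinuousLinearEquiv : F k →L[ℂ] H') ∘L R k ∘L
      ((e.map k).symm.toContinuousLinearEquiv : H' →L[ℂ] F k) with hT
  have hTa : ContMDiffOn (𝓡 d) 𝓘(ℝ, H' →L[ℂ] H') ω T e.base := by
    have := hRa e he
    rwa [univ_inter] at this
  have hTap : ∀ k v, T k (e.map k v) = e.map k (R k v) := fun k v => by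
    simp [hT]
  have hTap' : ∀ k v, T k v = e.map k (R k ((e.map k).symm v)) := fun k v => rfl
  set V : C →L[ℂ] H' := ((e.map k₀).toContinuousLinearEquiv : F k₀ →L[ℂ] H') ∘L V₀ with hVdef
  have hVap : ∀ c, V c = e.map k₀ (V₀ c) := fun c => rfl
  have hVi : ContinuousLinearMap.adjoint V ∘L V = ContinuousLinearMap.id ℂ C :=
    adjoint_comp_of_inner fun a b => by
      rw [hVap, hVap, LinearIsometryEquiv.inner_map_map, hV₀]
  have hV₀e : ∀ c, V₀ c ∈ eigenspace (H₀ k₀) l₀ := fun c => hV₀r ▸ LinearMap.mem_range_self _ c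
  have hTV : T k₀ ∘L V = r l₀ • V := by
    ext c
    change T k₀ (e.map k₀ (V₀ c)) = r l₀ • e.map k₀ (V₀ c)
    rw [hTap, (hR k₀).mem_eigenspace_iff.1 (hV₀e c), map_smul]
  have hTin : ∀ c v, inner ℂ (V c) (T k₀ v) = r l₀ * inner ℂ (V c) v := fun c v => by
    have := (hR k₀).inner_eigenspace (hH₀.selfAdjoint k₀) (hV₀e c) ((e.map k₀).symm v)
    rw [← LinearIsometryEquiv.inner_map_map (e.map k₀), ← LinearIsometryEquiv.inner_map_map
      (e.map k₀) (V₀ c), LinearIsometryEquiv.apply_symm_apply] at this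
    exact this
  have hTker : ∀ v, T k₀ v = r l₀ • v → v ∈ range V := fun v hv => by
    have h1 : R k₀ ((e.map k₀).symm v) = r l₀ • (e.map k₀).symm v := by
      apply (e.map k₀).injective
      rw [map_smul, LinearIsometryEquiv.apply_symm_apply, ← hv]
      rfl
    have h2 := (hR k₀).mem_eigenspace_iff.2 h1
    rw [← hV₀r] at h2
    obtain ⟨c, hc⟩ := h2
    refine ⟨c, ?_⟩
    have hc' : V₀ c = (e.map k₀).symm v := hc
    rw [hVap, hc', LinearIsometryEquiv.apply_symm_apply]
  have hTc : IsCompactOperator (T k₀) :=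
    ((hRc k₀).comp_clm ((e.map k₀).symm.toContinuousLinearEquiv : H' →L[ℂ] F k₀)).clm_comp
      ((e.map k₀).toContinuousLinearEquiv : F k₀ →L[ℂ] H')
  obtain ⟨W, g, δ, hδ, hg0, hall⟩ := exists_analytic_compression hTc hVi hTV hTin hTker
  have hTk : ContinuousAt T k₀ :=
    hTa.continuousOn.continuousAt ((𝒜.isOpen_base e he).mem_nhds hk₀)
  obtain ⟨w, hw, hwo, hkw⟩ := eventually_nhds_iff.1
    ((hTk.eventually hall).and ((𝒜.isOpen_base e he).mem_nhds hk₀))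
  have hTaw : ContMDiffOn (𝓡 d) 𝓘(ℝ, H' →L[ℂ] H') ω T w := hTa.mono fun k hk => (hw k hk).2
  refine ⟨w, fun k => ((e.map k).symm.toContinuousLinearEquiv : H' →L[ℂ] F k) ∘L W (T k),
    fun k => g (T k), δ, hδ, hkw, ?_, hg0⟩
  have hin : ∀ k, ∀ a b : C, inner ℂ ((e.map k).symm (W (T k) a)) ((e.map k).symm (W (T k) b)) =
      inner ℂ (W (T k) a) (W (T k) b) := fun k a b => LinearIsometryEquiv.inner_map_map _ _ _
  have hiso : ∀ k ∈ w, ContinuousLinearMap.adjoint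
      (((e.map k).symm.toContinuousLinearEquiv : H' →L[ℂ] F k) ∘L W (T k)) ∘L
      (((e.map k).symm.toContinuousLinearEquiv : H' →L[ℂ] F k) ∘L W (T k)) =
      ContinuousLinearMap.id ℂ C := fun k hk => adjoint_comp_of_inner fun a b => by
    rw [← inner_map_of_adjoint_comp (hw k hk).1.2.1 a b]
    exact hin k a b
  have hint : ∀ k ∈ w, Intertwines (H₀ k)
      (((e.map k).symm.toContinuousLinearEquiv : H' →L[ℂ] F k) ∘L W (T k)) (g (T k)) := by
    intro k hk c
    obtain ⟨N, hN, hgN⟩ := (hw k hk).1.2.2.1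
    obtain ⟨h1, h2⟩ := (hR k).apply_eq ((e.map k).symm (W (T k) (N c)))
    have h3 : R k ((e.map k).symm (W (T k) (N c))) = (e.map k).symm (W (T k) c) := by
      apply (e.map k).injective
      rw [← hTap', LinearIsometryEquiv.apply_symm_apply, hN]
    simp only [h3] at h1 h2
    refine ⟨h1, h2.trans ?_⟩
    change _ = (e.map k).symm (W (T k) (g (T k) c))
    rw [hgN, map_sub, map_sub, map_smul, map_smul]
  refine ⟨hwo, ?_, ?_, hiso, hint, ?_⟩
  · intro e' he'
    have h1 : ContMDiffOn (𝓡 d) 𝓘(ℝ, C →L[ℂ] H') ω (fun k => W (T k)) (w ∩ e'.base) :=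
      fun k hk => (hw k hk.1).1.1.1.contMDiffAt.comp_contMDiffWithinAt k
        (hTaw.mono inter_subset_left k hk)
    exact contMDiffOn_real_comp ((𝒜.analytic_transition e he e' he').mono
      fun k hk => ⟨(hw k hk.1).2, hk.2⟩) h1
  · intro k hk
    exact (hw k hk).1.1.2.contMDiffAt.comp_contMDiffWithinAt k (hTaw k hk)
  · intro k hk l hl v hv
    have h1 := (hint k hk).sub_mem_eigenspace (hH₀.selfAdjoint k) (hiso k hk) hv
    have h0 := adjoint_apply_apply (hiso k hk)
    set X := ((e.map k).symm.toContinuousLinearEquiv : H' →L[ℂ] F k) ∘L W (T k) with hX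
    set v' := v - X (ContinuousLinearMap.adjoint X v) with hv'
    have h2 : bordered (T k) (r l) (W (T k)) (e.map k v', 0) = 0 := by
      rw [bordered_apply, Prod.mk_eq_zero]
      constructor
      · change T k (e.map k v') - r l • e.map k v' - W (T k) 0 = 0
        rw [hTap, (hR k).mem_eigenspace_iff.1 h1, map_smul, map_zero, sub_zero, sub_self]
      · change ContinuousLinearMap.adjoint (W (T k)) (e.map k v') = 0
        refine ext_inner_left ℂ fun c => ?_
        rw [ContinuousLinearMap.adjoint_inner_right, inner_zero_right]
        have h3 : W (T k) c = e.map k (X c) := by simp [hX]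
        rw [h3, LinearIsometryEquiv.inner_map_map, ← ContinuousLinearMap.adjoint_inner_right, hv',
          map_sub, h0, sub_self, inner_zero_right]
    have h4 := (hw k hk).1.2.2.2 l hl (h2.trans (map_zero _).symm)
    have h5 : v' = 0 := by
      have h6 : e.map k v' = 0 := congrArg Prod.fst h4
      simpa using h6
    exact ⟨ContinuousLinearMap.adjoint X v, (sub_eq_zero.1 h5).symm⟩

end LocalFrame

/-! ### Analytic vector fields and derivatives along them. -/

section VectorField

variable {d : ℕ} {M : Type*} [TopologicalSpace M] [ChartedSpace (EuclideanSpace ℝ (Fin d)) M]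

/-- The field is constant in a local trivialization of the tangent bundle. -/
theorem exists_analyticVectorField [IsManifold (𝓡 d) ω M] (k₀ : M) (v : TangentSpace (𝓡 d) k₀) :
    ∃ (X : ∀ k : M, TangentSpace (𝓡 d) k) (w : Set M), IsOpen w ∧ k₀ ∈ w ∧
      IsAnalyticVectorField w X ∧ X k₀ = v := by
  set e := trivializationAt (EuclideanSpace ℝ (Fin d)) (TangentSpace (𝓡 d) : M → Type _) k₀ with he
  have hk : k₀ ∈ e.baseSet := FiberBundle.mem_baseSet_trivializationAt' k₀
  set v' := (e ⟨k₀, v⟩).2 with hv'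
  refine ⟨fun k => e.symm k v', e.baseSet, e.open_baseSet, hk, ?_, ?_⟩
  · have h1 := e.contMDiffOn_symm (IB := 𝓡 d) (n := ω)
    have h2 : ContMDiffOn (𝓡 d) ((𝓡 d).prod 𝓘(ℝ, EuclideanSpace ℝ (Fin d))) ω
        (fun k : M => (k, v')) e.baseSet := (contMDiff_id.prodMk contMDiff_const).contMDiffOn
    have h3 := h1.comp h2 (fun k hk => by
      rw [mem_preimage, e.mem_target]
      exact hk)
    refine h3.congr fun k hk => ?_
    exact e.mk_symm hk v'
  · change e.symm k₀ v' = v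
    exact e.symm_apply_apply_mk hk v

variable {V : Type*} [NormedAddCommGroup V] [NormedSpace ℝ V]
  {V' : Type*} [NormedAddCommGroup V'] [NormedSpace ℝ V']
  {X : ∀ k : M, TangentSpace (𝓡 d) k} {f g : M → V} {k : M}

theorem derivAlong_congr (h : f =ᶠ[𝓝 k] g) : derivAlong X f k = derivAlong X g k := by
  unfold derivAlong
  rw [h.mfderiv_eq]
  rfl

theorem derivAlong_clm (L : V →L[ℝ] V') (hf : MDifferentiableAt (𝓡 d) 𝓘(ℝ, V) f k) :
    derivAlong X (fun q => L (f q)) k = L (derivAlong X f k) := by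
  have h := (L.hasMFDerivAt (x := f k)).comp k hf.hasMFDerivAt
  unfold derivAlong
  rw [show (fun q => L (f q)) = L ∘ f from rfl, h.mfderiv]
  rfl

theorem continuousOn_derivAlong [IsManifold (𝓡 d) ω M] {w : Set M} (hw : IsOpen w)
    (hf : ContMDiffOn (𝓡 d) 𝓘(ℝ, V) ω f w) (hX : IsAnalyticVectorField w X) :
    ContinuousOn (derivAlong X f) w := by
  have h1 := hf.continuousOn_tangentMapWithin (by simp) hw.uniqueMDiffOn
  have h2 : ContinuousOn (fun k => (⟨k, X k⟩ : TangentBundle (𝓡 d) M)) w := hX.continuousOn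
  have h3 := h1.comp h2 (fun k hk => hk)
  have h4 := (tangentBundleModelSpaceHomeomorph 𝓘(ℝ, V)).continuous.comp_continuousOn h3
  have h5 := continuous_snd.comp_continuousOn (f := fun x =>
    ((tangentBundleModelSpaceHomeomorph 𝓘(ℝ, V))
      ((tangentMapWithin (𝓡 d) 𝓘(ℝ, V) f w) ⟨x, X x⟩) : V × V)) h4
  refine h5.congr fun k hk => ?_
  have h6 : MDifferentiableAt (𝓡 d) 𝓘(ℝ, V) f k :=
    (hf.contMDiffAt (hw.mem_nhds hk)).mdifferentiableAt (by simp)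
  change mfderiv (𝓡 d) 𝓘(ℝ, V) f k (X k) = mfderivWithin (𝓡 d) 𝓘(ℝ, V) f w k (X k)
  rw [mfderivWithin_of_isOpen hw hk]

variable {C : Type*} [NormedAddCommGroup C] [InnerProductSpace ℂ C]
  {D : Type*} [NormedAddCommGroup D] [InnerProductSpace ℂ D]

theorem isBoundedBilinearMap_real_apply :
    IsBoundedBilinearMap ℝ (fun p : (C →L[ℂ] D) × C => p.1 p.2) where
  add_left _ _ _ := rfl
  smul_left _ _ _ := rfl
  add_right _ _ _ := map_add _ _ _
  smul_right r A x := by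
    rw [← Complex.coe_smul, map_smul, Complex.coe_smul]
  bound := ⟨1, one_pos, fun A x => by rw [one_mul]; exact A.le_opNorm x⟩

theorem derivAlong_apply {h : M → (C →L[ℂ] D)} {c : M → C}
    (hh : MDifferentiableAt (𝓡 d) 𝓘(ℝ, C →L[ℂ] D) h k)
    (hc : MDifferentiableAt (𝓡 d) 𝓘(ℝ, C) c k) :
    derivAlong X (fun q => h q (c q)) k =
      derivAlong X h k (c k) + h k (derivAlong X c k) := by
  have h1 : HasMFDerivAt (𝓡 d) 𝓘(ℝ, (C →L[ℂ] D) × C) (fun q => (h q, c q)) k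
      ((mfderiv (𝓡 d) 𝓘(ℝ, C →L[ℂ] D) h k).prod (mfderiv (𝓡 d) 𝓘(ℝ, C) c k)) :=
    ⟨hh.continuousAt.prodMk hc.continuousAt, hh.hasMFDerivAt.2.prodMk hc.hasMFDerivAt.2⟩
  have h2 := ((isBoundedBilinearMap_real_apply (C := C) (D := D)).hasFDerivAt
    (h k, c k)).hasMFDerivAt
  have h3 := HasMFDerivAt.comp (f := fun q => (h q, c q)) k h2 h1
  unfold derivAlong
  rw [show (fun q => h q (c q)) = (fun p : (C →L[ℂ] D) × C => p.1 p.2) ∘ fun q => (h q, c q) from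
    rfl, h3.mfderiv]
  exact add_comm _ _

theorem conj_half : (starRingEnd ℂ) (1 / 2 : ℂ) = 1 / 2 := by
  rw [map_div₀, map_one, map_ofNat]

/-- Since `A - 1/2 = (A - 1) + 1/2`, the bound on `A - 1` is absorbed by the second term. -/
theorem isPositive_sub_half {A : C →L[ℂ] C} (hA : ∀ a b, inner ℂ (A a) b = inner ℂ a (A b))
    (h : ‖A - ContinuousLinearMap.id ℂ C‖ ≤ 1 / 2) :
    (A - (1 / 2 : ℂ) • ContinuousLinearMap.id ℂ C).IsPositive := by
  refine ⟨fun a b => ?_, fun a => ?_⟩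
  · change inner ℂ (A a - (1 / 2 : ℂ) • a) b = inner ℂ a (A b - (1 / 2 : ℂ) • b)
    rw [inner_sub_left, inner_sub_right, hA, inner_smul_left, inner_smul_right,
      conj_half]
  · set B := A - ContinuousLinearMap.id ℂ C with hB
    have h1 : (A - (1 / 2 : ℂ) • ContinuousLinearMap.id ℂ C) a = B a + (1 / 2 : ℂ) • a := by
      change A a - (1 / 2 : ℂ) • a = A a - a + (1 / 2 : ℂ) • a
      module
    rw [ContinuousLinearMap.reApplyInnerSelf_apply, h1, inner_add_left, inner_smul_left, map_add]
    have h2 : RCLike.re ((starRingEnd ℂ) (1 / 2 : ℂ) * inner ℂ a a) = 1 / 2 * ‖a‖ ^ 2 := by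
      rw [inner_self_eq_norm_sq_to_K]
      rw [conj_half]
      have : (1 / 2 : ℂ) * ((‖a‖ : ℝ) : ℂ) ^ 2 = ((1 / 2 * ‖a‖ ^ 2 : ℝ) : ℂ) := by
        simp
      erw [this]
      exact Complex.ofReal_re _
    rw [h2]
    have h3 : |RCLike.re (inner ℂ (B a) a)| ≤ 1 / 2 * ‖a‖ ^ 2 :=
      calc |RCLike.re (inner ℂ (B a) a)| ≤ ‖inner ℂ (B a) a‖ := RCLike.abs_re_le_norm _
        _ ≤ ‖B a‖ * ‖a‖ := norm_inner_le_norm _ _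
        _ ≤ (‖B‖ * ‖a‖) * ‖a‖ := by gcongr; exact B.le_opNorm a
        _ ≤ (1 / 2 * ‖a‖) * ‖a‖ := by gcongr
        _ = _ := by ring
    linarith [neg_abs_le (RCLike.re (inner ℂ (B a) a))]

/-- The adjoint is real linear and continuous, so it commutes with the derivative. -/
theorem derivAlong_symmetric [CompleteSpace C] {h : M → (C →L[ℂ] C)} {w : Set M}
    (hw : w ∈ 𝓝 k)
    (hs : ∀ q ∈ w, ∀ a b, inner ℂ (h q a) b = inner ℂ a (h q b))
    (hd : MDifferentiableAt (𝓡 d) 𝓘(ℝ, C →L[ℂ] C) h k) (a b : C) :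
    inner ℂ (derivAlong X h k a) b = inner ℂ a (derivAlong X h k b) := by
  have h1 : (fun q => adjointReal C C (h q)) =ᶠ[𝓝 k] h := by
    filter_upwards [hw] with q hq
    exact ((ContinuousLinearMap.eq_adjoint_iff _ _).2 (hs q hq)).symm
  have h2 : adjointReal C C (derivAlong X h k) = derivAlong X h k := by
    rw [← derivAlong_clm (adjointReal C C) hd]
    exact derivAlong_congr h1
  rw [adjointReal_apply] at h2
  nth_rw 1 [← h2]
  rw [ContinuousLinearMap.adjoint_inner_left]

end VectorField

/-! ### Monotonicity of the local matrix, and the covariant derivative. -/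

section FrameDerivative

variable {d : ℕ} {M : Type*} [TopologicalSpace M] [ChartedSpace (EuclideanSpace ℝ (Fin d)) M]

theorem mdifferentiableAt_real_apply {C : Type*} [NormedAddCommGroup C] [InnerProductSpace ℂ C]
    {D : Type*} [NormedAddCommGroup D] [InnerProductSpace ℂ D] {k : M}
    {h : M → (C →L[ℂ] D)} {c : M → C}
    (hh : MDifferentiableAt (𝓡 d) 𝓘(ℝ, C →L[ℂ] D) h k)
    (hc : MDifferentiableAt (𝓡 d) 𝓘(ℝ, C) c k) :
    MDifferentiableAt (𝓡 d) 𝓘(ℝ, D) (fun q => h q (c q)) k := by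
  have h2 := ((isBoundedBilinearMap_real_apply (C := C) (D := D)).differentiableAt
    (h k, c k)).mdifferentiableAt
  exact MDifferentiableAt.comp (f := fun q => (h q, c q)) k h2 (hh.prodMk_space hc)

variable {F : M → Type*} [∀ k, NormedAddCommGroup (F k)] [∀ k, InnerProductSpace ℂ (F k)]
  [∀ k, CompleteSpace (F k)]
  {H' : Type*} [NormedAddCommGroup H'] [InnerProductSpace ℂ H']
  {𝒜 : HilbertBundleAtlas d F H'} {H₀ : ∀ k, F k →ₗ.[ℂ] F k} {w : Set M}
  {l₀ δ : ℝ} {μ : ℕ} {W : ∀ k, EuclideanSpace ℂ (Fin μ) →L[ℂ] F k}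
  {h : M → (EuclideanSpace ℂ (Fin μ) →L[ℂ] EuclideanSpace ℂ (Fin μ))}

theorem IsLocalFrame.injective (hw : IsLocalFrame 𝒜 H₀ w l₀ δ W h) {k : M} (hk : k ∈ w) :
    Function.Injective (W k) :=
  Function.LeftInverse.injective (adjoint_apply_apply (hw.isometry k hk))

theorem IsLocalFrame.finrank_range (hw : IsLocalFrame 𝒜 H₀ w l₀ δ W h) {k : M} (hk : k ∈ w) :
    Module.finrank ℂ (LinearMap.range (W k : EuclideanSpace ℂ (Fin μ) →ₗ[ℂ] F k)) = μ := by
  rw [LinearMap.finrank_range_of_inj (hw.injective hk), finrank_euclideanSpace_fin]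

theorem IsLocalFrame.rank_le (hw : IsLocalFrame 𝒜 H₀ w l₀ δ W h) {k : M} (hk : k ∈ w) {l : ℝ}
    (hl : |l - l₀| < δ) {ν : ℕ} (hν : Module.rank ℂ (eigenspace (H₀ k) l) = ν) : ν ≤ μ := by
  have h1 := Submodule.finrank_mono (hw.eigenspace_le k hk l hl)
  rwa [hw.finrank_range hk, Module.finrank_eq_of_rank_eq hν] at h1

theorem IsLocalFrame.eigenspace_eq (hw : IsLocalFrame 𝒜 H₀ w l₀ δ W h) {k : M} (hk : k ∈ w) {l : ℝ}
    (hl : |l - l₀| < δ) (hμ : Module.rank ℂ (eigenspace (H₀ k) l) = μ) :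
    eigenspace (H₀ k) l = LinearMap.range (W k : EuclideanSpace ℂ (Fin μ) →ₗ[ℂ] F k) := by
  refine Submodule.eq_of_le_of_finrank_eq (hw.eigenspace_le k hk l hl) ?_
  rw [hw.finrank_range hk, Module.finrank_eq_of_rank_eq hμ]

/-- When the multiplicity equals the rank of the frame, the eigenspace fills the whole range of `W
k`, so the matrix is scalar. This happens at the points of the stratum of the center. -/
theorem IsLocalFrame.matrix_eq (hw : IsLocalFrame 𝒜 H₀ w l₀ δ W h) {k : M} (hk : k ∈ w) {l : ℝ}
    (hl : |l - l₀| < δ) (hμ : Module.rank ℂ (eigenspace (H₀ k) l) = μ) :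
    h k = (l : ℂ) • ContinuousLinearMap.id ℂ (EuclideanSpace ℂ (Fin μ)) := by
  ext1 c
  have h1 : W k c ∈ eigenspace (H₀ k) l := by
    rw [hw.eigenspace_eq hk hl hμ]
    exact LinearMap.mem_range_self _ c
  obtain ⟨h2, h3⟩ := mem_eigenspace_iff.1 h1
  obtain ⟨h4, h5⟩ := hw.intertwines k hk c
  refine hw.injective hk ?_
  rw [← h5]
  change _ = W k ((l : ℂ) • c)
  rw [map_smul, ← h3]

theorem IsLocalFrame.spectralProj_eq {r : ℝ} (hw : IsLocalFrame 𝒜 H₀ w l₀ r W h) {k : M}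
    (hH₀ : IsSelfAdjoint (H₀ k)) (hk : k ∈ w)
    (hh : ‖h k - (l₀ : ℂ) • ContinuousLinearMap.id ℂ _‖ < r) :
    spectralProj (H₀ k) (Metric.ball l₀ r) = W k ∘L ContinuousLinearMap.adjoint (W k) :=
  spectralProj_eq_of_iSup (hw.isometry k hk)
    ((hw.intertwines k hk).iSup_eigenspace hH₀ (hw.isometry k hk)
      (hw.eigenspace_le k hk) hh subset_rfl)

theorem range_comp_adjoint {C E : Type*} [NormedAddCommGroup C] [InnerProductSpace ℂ C]
    [CompleteSpace C] [NormedAddCommGroup E] [InnerProductSpace ℂ E] [CompleteSpace E]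
    {W : C →L[ℂ] E} (hW : ContinuousLinearMap.adjoint W ∘L W = ContinuousLinearMap.id ℂ C) :
    LinearMap.range ((W ∘L ContinuousLinearMap.adjoint W : E →L[ℂ] E) : E →ₗ[ℂ] E) =
      LinearMap.range (W : C →ₗ[ℂ] E) := by
  ext v
  constructor
  · rintro ⟨u, rfl⟩
    exact ⟨_, rfl⟩
  · rintro ⟨u, rfl⟩
    exact ⟨W u, congrArg W (adjoint_apply_apply hW u)⟩

theorem IsLocalFrame.mdifferentiableAt (hw : IsLocalFrame 𝒜 H₀ w l₀ δ W h) {k : M} (hk : k ∈ w) :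
    MDifferentiableAt (𝓡 d) 𝓘(ℝ, EuclideanSpace ℂ (Fin μ) →L[ℂ] EuclideanSpace ℂ (Fin μ)) h k :=
  (hw.analytic_matrix.contMDiffAt (hw.isOpen.mem_nhds hk)).mdifferentiableAt (by simp)

/-- Along a stratum on which the energy has rank one, the matrix `h` has a direction in which its
derivative is the identity. -/
theorem IsLocalFrame.exists_velocity {x : M × ℝ} (hw : IsLocalFrame 𝒜 H₀ w x.2 δ W h)
    (hk₀ : x.1 ∈ w) (hδ : 0 < δ) {S : Set (M × ℝ)} (hS : S ⊆ multStratum H₀ μ) (hkS : x ∈ S)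
    (hrk : EnergyRankOne d S) :
    ∃ v : TangentSpace (𝓡 d) x.1, mfderiv (𝓡 d)
      𝓘(ℝ, EuclideanSpace ℂ (Fin μ) →L[ℂ] EuclideanSpace ℂ (Fin μ)) h x.1 v =
        ContinuousLinearMap.id ℂ (EuclideanSpace ℂ (Fin μ)) := by
  obtain ⟨v, ⟨γ, rfl, hγS, hγ⟩, hv⟩ := hrk _ hkS
  have hvs : dEnergy d (γ 0) v = v.2 := by
    unfold dEnergy
    rw [mfderiv_snd]
    rfl
  rw [hvs] at hv
  have hγc : ContinuousAt γ 0 := hγ.continuousAt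
  let L : ℝ →L[ℝ] (EuclideanSpace ℂ (Fin μ) →L[ℂ] EuclideanSpace ℂ (Fin μ)) :=
    ContinuousLinearMap.toSpanSingleton ℝ (ContinuousLinearMap.id ℂ (EuclideanSpace ℂ (Fin μ)))
  -- Along a curve in `S` the matrix is the energy times the identity. Differentiating at `0` gives
  -- `a` times the identity, where `a ≠ 0` is the energy component of the velocity; dividing by `a`
  -- gives the required vector.
  have hcong : h ∘ Prod.fst ∘ γ =ᶠ[𝓝 0] L ∘ Prod.snd ∘ γ := by
    have h1 : ∀ᶠ t in 𝓝 (0 : ℝ), (γ t).1 ∈ w :=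
      (continuous_fst.continuousAt.comp hγc).eventually (hw.isOpen.mem_nhds hk₀)
    have h2 : ∀ᶠ t in 𝓝 (0 : ℝ), |(γ t).2 - (γ 0).2| < δ :=
      (continuous_snd.continuousAt.comp hγc).eventually (Metric.ball_mem_nhds _ hδ)
    filter_upwards [h1, h2, hγS] with t ht1 ht2 ht3
    refine (hw.matrix_eq ht1 ht2 (hS ht3).2).trans ?_
    exact algebraMap_smul ℂ (γ t).2 (ContinuousLinearMap.id ℂ (EuclideanSpace ℂ (Fin μ)))
  have hd1 := (hw.mdifferentiableAt hk₀).hasMFDerivAt.comp (0 : ℝ)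
    ((hasMFDerivAt_fst (γ 0)).comp (0 : ℝ) hγ)
  have hd2 := (L.hasMFDerivAt (x := (γ 0).2)).comp (0 : ℝ)
    ((hasMFDerivAt_snd (γ 0)).comp (0 : ℝ) hγ)
  have hd := DFunLike.congr_fun (hasMFDerivAt_unique (hd1.congr_of_eventuallyEq hcong.symm) hd2)
    (1 : ℝ)
  obtain ⟨v₁, a, ha, hd3⟩ : ∃ (v₁ : TangentSpace (𝓡 d) (γ 0).1) (a : ℝ), a ≠ 0 ∧
      mfderiv (𝓡 d) 𝓘(ℝ, EuclideanSpace ℂ (Fin μ) →L[ℂ] EuclideanSpace ℂ (Fin μ)) h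
        (γ 0).1 ((1 : ℝ) • v₁) = ((1 : ℝ) • a) •
        ContinuousLinearMap.id ℂ (EuclideanSpace ℂ (Fin μ)) :=
    ⟨v.1, v.2, hv, hd⟩
  rw [one_smul, one_smul] at hd3
  refine ⟨a⁻¹ • v₁, ?_⟩
  rw [map_smul, hd3]
  exact inv_smul_smul₀ ha _

/-- The velocity is extended to an analytic field. The derivative of `h` is the identity at the
center, so by continuity it stays within `1/2` of it nearby. -/
theorem IsLocalFrame.exists_vectorField [IsManifold (𝓡 d) ω M] {x : M × ℝ}
    (hH₀ : ∀ k, IsSelfAdjoint (H₀ k))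
    (hw : IsLocalFrame 𝒜 H₀ w x.2 δ W h)
    (hk₀ : x.1 ∈ w) (hδ : 0 < δ) {S : Set (M × ℝ)} (hS : S ⊆ multStratum H₀ μ) (hkS : x ∈ S)
    (hrk : EnergyRankOne d S) :
    ∃ (X : ∀ k : M, TangentSpace (𝓡 d) k) (w' : Set M), IsOpen w' ∧ x.1 ∈ w' ∧ w' ⊆ w ∧
      IsAnalyticVectorField w' X ∧ ∀ k ∈ w', (derivAlong X h k - (1 / 2 : ℂ) •
        ContinuousLinearMap.id ℂ (EuclideanSpace ℂ (Fin μ))).IsPositive := by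
  obtain ⟨v, hv⟩ := hw.exists_velocity hk₀ hδ hS hkS hrk
  obtain ⟨X, w₁, hw₁o, hk₁, hX, hXv⟩ := exists_analyticVectorField x.1 v
  have hX' : IsAnalyticVectorField (w ∩ w₁) X := ContMDiffOn.mono hX inter_subset_right
  have hc := continuousOn_derivAlong (hw.isOpen.inter hw₁o)
    (hw.analytic_matrix.mono inter_subset_left) hX'
  have hD : derivAlong X h x.1 = ContinuousLinearMap.id ℂ (EuclideanSpace ℂ (Fin μ)) := by
    unfold derivAlong
    rw [hXv]
    exact hv
  have hn := hc.isOpen_inter_preimage (hw.isOpen.inter hw₁o) (Metric.isOpen_ball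
    (x := ContinuousLinearMap.id ℂ (EuclideanSpace ℂ (Fin μ))) (ε := 1 / 2))
  refine ⟨X, _, hn, ⟨⟨hk₀, hk₁⟩, ?_⟩, fun k hk => hk.1.1, hX'.mono inter_subset_left,
    fun k hk => ?_⟩
  · rw [mem_preimage, hD]
    exact Metric.mem_ball_self (by norm_num)
  · refine isPositive_sub_half ?_ (mem_ball_iff_norm.1 hk.2).le
    exact derivAlong_symmetric (hw.isOpen.mem_nhds hk.1.1)
      (fun q hq => (hw.intertwines q hq).symmetric (hH₀ q) (hw.isometry q hq))
      (hw.mdifferentiableAt hk.1.1)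

/-- In the coordinates `c = W† s` the endomorphism acts as `h`, and the product rule gives `X (h c)
- h (X c) = (X h) c`. -/
theorem IsLocalFrame.isEndCovDeriv [CompleteSpace H'] (hw : IsLocalFrame 𝒜 H₀ w l₀ δ W h)
    (X : ∀ k : M, TangentSpace (𝓡 d) k) {P A : ∀ k, F k →L[ℂ] F k}
    (hP : ∀ k ∈ w, P k = W k ∘L ContinuousLinearMap.adjoint (W k))
    (hA : ∀ k ∈ w, A k = W k ∘L h k ∘L ContinuousLinearMap.adjoint (W k)) :
    IsEndCovDeriv 𝒜 w W X P A
      (fun k => W k ∘L derivAlong X h k ∘L ContinuousLinearMap.adjoint (W k)) := by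
  refine ⟨fun k hk => ?_, fun s hs hPs k hk => ?_⟩
  · have h1 := adjoint_apply_apply (hw.isometry k hk)
    ext v
    simp only [hP k hk, ContinuousLinearMap.comp_apply, h1]
  · have h1 := adjoint_apply_apply (hw.isometry k hk)
    have hwk := hw.isOpen.mem_nhds hk
    set c : M → EuclideanSpace ℂ (Fin μ) := fun q => ContinuousLinearMap.adjoint (W q) (s q)
    have hc : MDifferentiableAt (𝓡 d) 𝓘(ℝ, EuclideanSpace ℂ (Fin μ)) c k := by
      obtain ⟨e, he, hke⟩ := 𝒜.cover k
      have hn : w ∩ e.base ∈ 𝓝 k := (hw.isOpen.inter (𝒜.isOpen_base e he)).mem_nhds ⟨hk, hke⟩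
      have h2 := ((hw.analytic_frame e he).contMDiffAt hn).mdifferentiableAt (by simp)
      have h3 := ((hs e he).contMDiffAt hn).mdifferentiableAt (by simp)
      have h4 := (adjointReal H' (EuclideanSpace ℂ (Fin μ))).differentiableAt.mdifferentiableAt.comp
        k h2
      have h5 := mdifferentiableAt_real_apply h4 h3
      -- A trivialization is unitary, so `W† s` is unchanged when both `W` and `s` are read in it.
      refine h5.congr_of_eventuallyEq (Eventually.of_forall fun q => ?_)
      refine ext_inner_right ℂ fun a => ?_
      change inner ℂ (ContinuousLinearMap.adjoint (W q) (s q)) a =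
        inner ℂ (ContinuousLinearMap.adjoint _ (e.map q (s q))) a
      rw [ContinuousLinearMap.adjoint_inner_left, ContinuousLinearMap.adjoint_inner_left]
      exact (LinearIsometryEquiv.inner_map_map (e.map q) _ _).symm
    have h6 : (fun q => ContinuousLinearMap.adjoint (W q) (A q (s q))) =ᶠ[𝓝 k]
        fun q => h q (c q) := by
      filter_upwards [hwk] with q hq
      rw [hA q hq]
      exact adjoint_apply_apply (hw.isometry q hq) _
    unfold covDeriv
    rw [derivAlong_congr h6, derivAlong_apply (hw.mdifferentiableAt hk) hc, hA k hk]
    change W k (derivAlong X h k (c k)) = W k (derivAlong X h k (c k) + h k (derivAlong X c k)) -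
      W k (h k (ContinuousLinearMap.adjoint (W k) (W k (derivAlong X c k))))
    rw [h1, map_add, add_sub_cancel_right]

theorem isPositive_conj_sub {C E : Type*} [NormedAddCommGroup C] [InnerProductSpace ℂ C]
    [CompleteSpace C] [NormedAddCommGroup E] [InnerProductSpace ℂ E] [CompleteSpace E]
    {D : C →L[ℂ] C} (hD : (D - (1 / 2 : ℂ) • ContinuousLinearMap.id ℂ C).IsPositive)
    (W : C →L[ℂ] E) : (W ∘L D ∘L ContinuousLinearMap.adjoint W -
      (1 / 2 : ℂ) • (W ∘L ContinuousLinearMap.adjoint W)).IsPositive := by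
  have := hD.conj_adjoint W
  convert this using 1
  ext v
  simp

end FrameDerivative

/-! ### Closedness of the characteristic variety, and spectral gaps. -/

section CharacteristicVariety

variable {d : ℕ} {M : Type*} [TopologicalSpace M] [ChartedSpace (EuclideanSpace ℝ (Fin d)) M]
  {F : M → Type*} [∀ k, NormedAddCommGroup (F k)] [∀ k, InnerProductSpace ℂ (F k)]
  [∀ k, CompleteSpace (F k)]
  {H' : Type*} [NormedAddCommGroup H'] [InnerProductSpace ℂ H']
  {𝒜 : HilbertBundleAtlas d F H'} {H₀ : ∀ k, F k →ₗ.[ℂ] F k}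

/-- The proper projection to the energy axis factors through the inclusion in `M × ℝ`, which is
therefore proper, hence closed. -/
theorem IsAnalyticallyFibered.isClosed [T2Space M] (hH₀ : IsAnalyticallyFibered 𝒜 H₀) :
    IsClosed (charVariety H₀) := by
  have h : IsProperMap (Subtype.val : charVariety H₀ → M × ℝ) :=
    isProperMap_of_comp_of_t2 continuous_subtype_val continuous_snd hH₀.proper
  have := h.isClosedMap.isClosed_range
  rwa [Subtype.range_coe] at this

theorem IsAnalyticallyFibered.isCompact (hH₀ : IsAnalyticallyFibered 𝒜 H₀) {B : Set ℝ}
    (hB : IsCompact B) : IsCompact (energyPreimage H₀ B) := by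
  have h := (hH₀.proper.isCompact_preimage hB).image continuous_subtype_val
  convert h
  ext x
  constructor
  · rintro ⟨h1, h2⟩
    exact ⟨⟨x, h1⟩, h2, rfl⟩
  · rintro ⟨⟨y, hy⟩, h2, rfl⟩
    exact ⟨hy, h2⟩

/-- The spectrum of `H₀ x.1` within `ε` of `x.2` is reduced to `x.2`. -/
def IsSpectralGap (H₀ : ∀ k, F k →ₗ.[ℂ] F k) (x : M × ℝ) (ε : ℝ) : Prop :=
  ∀ l ∈ realSpectrum (H₀ x.1), |l - x.2| ≤ ε → l = x.2

/-- Over the center itself the frame is exactly the eigenspace of `x.2`. An eigenvector with another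
nearby energy would belong to it, which is impossible. -/
theorem IsAnalyticallyFibered.eventually_isSpectralGap [CompleteSpace H']
    (hH₀ : IsAnalyticallyFibered 𝒜 H₀) {x : M × ℝ} {μ : ℕ} (hx : x ∈ multStratum H₀ μ) :
    ∀ᶠ ε in 𝓝[>] (0 : ℝ), IsSpectralGap H₀ x ε := by
  obtain ⟨w, W, h, δ, hδ, hxw, hw, -⟩ := exists_isLocalFrame hH₀ x.1 x.2 hx.2
  obtain ⟨R, hR, hRc, -⟩ := hH₀.resolvent
  filter_upwards [Ioo_mem_nhdsGT hδ] with ε hε l hl hlx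
  by_contra hne
  obtain ⟨v, hv, hv0⟩ := (hR x.1).exists_eigenvector (hRc x.1) hl
  have h1 := hw.eigenspace_le x.1 hxw l (lt_of_le_of_lt hlx hε.2) hv
  rw [← hw.eigenspace_eq hxw (by simpa using hδ) hx.2] at h1
  exact hv0 (eq_zero_of_mem_eigenspace_of_ne hne hv h1)

/-- The energies at distance between `η` and `ε` form a compact set that misses the closed variety
over `x.1`; the tube lemma extends this to nearby fibres. -/
theorem IsSpectralGap.exists_nhds {x : M × ℝ} {ε η : ℝ} (hcl : IsClosed (charVariety H₀))
    (hg : IsSpectralGap H₀ x ε) (hη : 0 < η) :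
    ∃ w : Set M, IsOpen w ∧ x.1 ∈ w ∧ ∀ k ∈ w, ∀ l ∈ realSpectrum (H₀ k),
      |l - x.2| < ε → |l - x.2| < η := by
  have hc : IsCompact (Metric.closedBall x.2 ε \ Metric.ball x.2 η) :=
    (isCompact_closedBall _ _).diff Metric.isOpen_ball
  have hsub : ({x.1} : Set M) ×ˢ (Metric.closedBall x.2 ε \ Metric.ball x.2 η) ⊆
      (charVariety H₀)ᶜ := by
    rintro ⟨k, l⟩ ⟨hk, hl1, hl2⟩ hkl
    obtain rfl : k = x.1 := hk
    have := hg l hkl hl1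
    subst this
    exact hl2 (Metric.mem_ball_self hη)
  obtain ⟨u, v, hu, -, hxu, hv, huv⟩ := generalized_tube_lemma isCompact_singleton hc
    hcl.isOpen_compl hsub
  refine ⟨u, hu, hxu rfl, fun k hk l hl hlε => ?_⟩
  by_contra hη'
  exact huv (mk_mem_prod hk (hv ⟨hlε.le, hη'⟩)) hl

end CharacteristicVariety

/-! ### The frontier order on strata. -/

section Strata

variable {d : ℕ} {M : Type*} [TopologicalSpace M] [ChartedSpace (EuclideanSpace ℝ (Fin d)) M]
  {F : M → Type*} [∀ k, NormedAddCommGroup (F k)] [∀ k, InnerProductSpace ℂ (F k)]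
  {H₀ : ∀ k, F k →ₗ.[ℂ] F k} {𝒮 : Set (Set (M × ℝ))} {S S' S'' : Set (M × ℝ)}

/-- Being locally a zero set, `S` is locally closed: near each of its points it coincides with its
closure. -/
theorem IsAnalyticSubmanifold.isClosed_frontier (hS : IsAnalyticSubmanifold d S) :
    IsClosed (closure S \ S) := by
  obtain ⟨c, hS⟩ := hS
  refine isClosed_of_closure_subset fun y hy => ?_
  refine ⟨closure_minimal sdiff_subset isClosed_closure hy, fun hyS => ?_⟩
  obtain ⟨U, hU, hyU, f, hf, -, hfS⟩ := hS y hyS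
  obtain ⟨z, hzU, hzS, hzS'⟩ := mem_closure_iff.1 hy U hU hyU
  have hz : z ∈ closure (S ∩ U) := by
    rw [inter_comm]
    exact hU.inter_closure ⟨hzU, hzS⟩
  have hfz := (hf.continuousOn.continuousAt (hU.mem_nhds hzU)).continuousWithinAt.mem_closure_image hz
  have hsub : f '' (S ∩ U) ⊆ {0} := by
    rw [hfS]
    rintro _ ⟨q, hq, rfl⟩
    exact hq.2
  have h0 : f z = 0 := by
    have := closure_mono hsub hfz
    rwa [closure_singleton] at this
  have : z ∈ S ∩ U := by
    rw [hfS]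
    exact ⟨hzU, h0⟩
  exact hzS' this.1

theorem IsStratification.subset_charVariety (h𝒮 : IsStratification d H₀ 𝒮) (hS : S ∈ 𝒮) :
    S ⊆ charVariety H₀ := h𝒮.sUnion_eq ▸ subset_sUnion_of_mem hS

theorem IsStratification.eq_or_subset (h𝒮 : IsStratification d H₀ 𝒮) (hS : S ∈ 𝒮) (hS' : S' ∈ 𝒮)
    {x : M × ℝ} (hx : x ∈ S) (hx' : x ∈ closure S') : S = S' ∨ S ⊆ closure S' \ S' :=
  h𝒮.frontier S' hS' S hS ⟨x, hx', hx⟩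

/-- The frontier of `S` is closed. If it contained `S'` it would contain the closure of `S'`, hence
`S` itself. -/
theorem IsStratification.asymm (h𝒮 : IsStratification d H₀ 𝒮) (hS : S ∈ 𝒮)
    (h : S ⊆ closure S' \ S') (h' : S' ⊆ closure S \ S) : False := by
  obtain ⟨x, hx⟩ := (h𝒮.connected S hS).nonempty
  exact (closure_minimal h' (h𝒮.submanifold S hS).isClosed_frontier (h hx).1).2 hx

theorem IsStratification.trans (h𝒮 : IsStratification d H₀ 𝒮) (hS : S ∈ 𝒮)
    (hS'' : S'' ∈ 𝒮) (h : S ⊆ closure S' \ S') (h' : S' ⊆ closure S'' \ S'') :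
    S ⊆ closure S'' \ S'' := by
  obtain ⟨x, hx⟩ := (h𝒮.connected S hS).nonempty
  have hx'' : x ∈ closure S'' :=
    closure_minimal (h'.trans sdiff_subset) isClosed_closure (h hx).1
  refine (h𝒮.eq_or_subset hS hS'' hx hx'').resolve_left ?_
  rintro rfl
  exact h𝒮.asymm hS h h'

theorem IsStratification.nhds (h𝒮 : IsStratification d H₀ 𝒮) (x : M × ℝ) :
    ∃ U ∈ 𝓝 x, ∀ S ∈ 𝒮, (U ∩ S).Nonempty → x ∈ closure S := by
  refine ⟨_, h𝒮.locallyFinite.closure.iInter_compl_mem_nhds (fun _ => isClosed_closure) x,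
    fun S hS ⟨y, hy, hyS⟩ => ?_⟩
  by_contra hx
  rw [mem_iInter₂] at hy
  exact hy ⟨S, hS⟩ hx (subset_closure hyS)

theorem IsStratification.finite_closure (h𝒮 : IsStratification d H₀ 𝒮) (x : M × ℝ) :
    {S ∈ 𝒮 | x ∈ closure S}.Finite := by
  have := (h𝒮.locallyFinite.closure.point_finite x).image (Subtype.val)
  refine this.subset ?_
  rintro S ⟨hS, hx⟩
  exact ⟨⟨S, hS⟩, hx, rfl⟩

theorem IsStratification.finite_inter (h𝒮 : IsStratification d H₀ 𝒮) {K : Set (M × ℝ)}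
    (hK : IsCompact K) : {S ∈ 𝒮 | (S ∩ K).Nonempty}.Finite := by
  have := (h𝒮.locallyFinite.finite_nonempty_inter_compact hK).image (Subtype.val)
  refine this.subset ?_
  rintro S ⟨hS, hx⟩
  exact ⟨⟨S, hS⟩, hx, rfl⟩

/-- Multiplicity is upper semicontinuous: eigenspaces at points of `S'` near a point of `S` embed in
the frame of rank `μ` there. -/
theorem IsStratification.multiplicity_le [∀ k, CompleteSpace (F k)]
    {H' : Type*} [NormedAddCommGroup H'] [InnerProductSpace ℂ H'] [CompleteSpace H']
    {𝒜 : HilbertBundleAtlas d F H'} (h𝒮 : IsStratification d H₀ 𝒮)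
    (hH₀ : IsAnalyticallyFibered 𝒜 H₀) (hS : S ∈ 𝒮) {μ μ' : ℕ} (hμ : S ⊆ multStratum H₀ μ)
    (hμ' : S' ⊆ multStratum H₀ μ') (h : S ⊆ closure S' \ S') : μ' ≤ μ := by
  obtain ⟨x, hx⟩ := (h𝒮.connected S hS).nonempty
  obtain ⟨w, W, h', δ, hδ, hxw, hw, -⟩ := exists_isLocalFrame hH₀ x.1 x.2 (hμ hx).2
  obtain ⟨y, ⟨hyw, hyδ⟩, hyS⟩ := mem_closure_iff.1 (h hx).1 (w ×ˢ Metric.ball x.2 δ)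
    (hw.isOpen.prod Metric.isOpen_ball) ⟨hxw, Metric.mem_ball_self hδ⟩
  exact hw.rank_le hyw hyδ (hμ' hyS).2

theorem multStratum_inj {μ μ' : ℕ} (hS : S.Nonempty) (hμ : S ⊆ multStratum H₀ μ)
    (hμ' : S ⊆ multStratum H₀ μ') : μ = μ' := by
  obtain ⟨x, hx⟩ := hS
  exact_mod_cast (hμ hx).2.symm.trans (hμ' hx).2

theorem IsStratification.energyRankOne (h𝒮 : IsStratification d H₀ 𝒮) (hS : S ∈ 𝒮) {x : M × ℝ}
    (hx : x ∈ S) (hxτ : x.2 ∉ thresholds d 𝒮) : EnergyRankOne d S := by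
  rcases h𝒮.energy S hS with h | h
  · exact h.2.2
  · exact absurd ⟨S, hS, h.2, x, hx, rfl⟩ hxτ

/-- Each of two distinct associated strata would lie in the frontier of the other, against
`IsStratification.asymm`. -/
theorem IsStratification.associated_unique (h𝒮 : IsStratification d H₀ 𝒮) {I : Set ℝ}
    {Ω : Set (M × ℝ)} (h : IsAssociatedStratum H₀ 𝒮 I Ω S) (h' : IsAssociatedStratum H₀ 𝒮 I Ω S') :
    S' = S := by
  obtain ⟨hne, T, -, hT, hST, hTΩ, hTS⟩ := h
  obtain ⟨hne', T', -, hT', hST', hTΩ', hTS'⟩ := h'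
  have key : ∀ (A B : Set (M × ℝ)) (T' : Set (Set (M × ℝ))), A ∈ 𝒮 → (Ω ∩ A).Nonempty →
      T' ⊆ strataOver H₀ 𝒮 I → Ω ∩ charVariety H₀ = ⋃ S' ∈ T', Ω ∩ S' →
      (∀ S' ∈ T', S' = B ∨ B ⊆ closure S' \ S') → A = B ∨ B ⊆ closure A \ A := by
    rintro A B T' hA ⟨y, hyΩ, hyA⟩ hT' hTΩ' hB
    have hy : y ∈ ⋃ S' ∈ T', Ω ∩ S' := hTΩ' ▸ ⟨hyΩ, h𝒮.subset_charVariety hA hyA⟩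
    obtain ⟨D, hD, -, hyD⟩ := mem_iUnion₂.1 hy
    have : A = D := by
      by_contra hne
      exact disjoint_left.1 (h𝒮.disjoint A hA D (hT' hD).1 hne) hyA hyD
    exact this ▸ hB D hD
  rcases key S' S T (hT' hST').1 hne' hT hTΩ hTS with h1 | h1
  · exact h1
  · rcases key S S' T' (hT hST).1 hne hT' hTΩ' hTS' with h2 | h2
    · exact h2.symm
    · exact (h𝒮.asymm (hT hST).1 h1 h2).elim

end Strata

/-! ### Cells adapted to the stratification. -/

/-- A cell: a base set, an energy interval given by its center and radius, and a stratum through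
the center. -/
structure Cell (M : Type*) where
  /-- the center, in the characteristic variety -/
  center : M × ℝ
  /-- half the length of the energy interval -/
  radius : ℝ
  /-- the base set -/
  base : Set M
  /-- the stratum of the center -/
  stratum : Set (M × ℝ)

/-- The energy interval of a cell. -/
def Cell.interval {M : Type*} (c : Cell M) : Set ℝ := Metric.ball c.center.2 c.radius

/-- The open set covered by a cell. -/
def Cell.set {M : Type*} (c : Cell M) : Set (M × ℝ) := c.base ×ˢ c.interval

section Cells

variable {d : ℕ} {M : Type*} [TopologicalSpace M] [ChartedSpace (EuclideanSpace ℝ (Fin d)) M]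
  {F : M → Type*} [∀ k, NormedAddCommGroup (F k)] [∀ k, InnerProductSpace ℂ (F k)]
  [∀ k, CompleteSpace (F k)]
  {H' : Type*} [NormedAddCommGroup H'] [InnerProductSpace ℂ H']

/-- A cell adapted to the stratification: over its base the spectrum of `H₀` in the energy interval
is concentrated near the center and is described by an analytic matrix which increases along an
analytic vector field, and only strata adherent to the center come close to it. -/
structure Cell.IsAdapted [IsManifold (𝓡 d) ω M] (c : Cell M) (𝒜 : HilbertBundleAtlas d F H')
    (H₀ : ∀ k, F k →ₗ.[ℂ] F k) (𝒮 : Set (Set (M × ℝ))) : Prop where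
  radius_pos : 0 < c.radius
  stratum_mem : c.stratum ∈ 𝒮
  center_mem : c.center ∈ c.stratum
  center_mem_base : c.center.1 ∈ c.base
  isOpen_base : IsOpen c.base
  isCompact_closure : IsCompact (closure c.base)
  gap : ∀ k ∈ c.base, ∀ l ∈ realSpectrum (H₀ k), |l - c.center.2| < c.radius →
    |l - c.center.2| < c.radius / 10
  adherent : ∀ S ∈ 𝒮, (closure (c.set ∩ charVariety H₀) ∩ S).Nonempty → c.center ∈ closure S
  energyRankOne : EnergyRankOne d c.stratum
  exists_frame : ∃ (μ : ℕ) (W : ∀ k, EuclideanSpace ℂ (Fin μ) →L[ℂ] F k)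
    (h : M → (EuclideanSpace ℂ (Fin μ) →L[ℂ] EuclideanSpace ℂ (Fin μ)))
    (X : ∀ k : M, TangentSpace (𝓡 d) k), c.stratum ⊆ multStratum H₀ μ ∧
    IsLocalFrame 𝒜 H₀ c.base c.center.2 c.radius W h ∧
    (∀ k ∈ c.base, ‖h k - (c.center.2 : ℂ) • ContinuousLinearMap.id ℂ _‖ < c.radius) ∧
    IsAnalyticVectorField c.base X ∧ ∀ k ∈ c.base, (derivAlong X h k - (1 / 2 : ℂ) •
      ContinuousLinearMap.id ℂ (EuclideanSpace ℂ (Fin μ))).IsPositive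

variable [IsManifold (𝓡 d) ω M] {𝒜 : HilbertBundleAtlas d F H'} {H₀ : ∀ k, F k →ₗ.[ℂ] F k}
  {𝒮 : Set (Set (M × ℝ))}

/-- The radius `ε` is fixed beforehand and only the base shrinks. By the gap, this alone brings the
trace of the cell on the variety into any neighborhood `U` of the center. -/
theorem exists_adapted_cell [T2Space M] [CompleteSpace H'] (hH₀ : IsAnalyticallyFibered 𝒜 H₀)
    (h𝒮 : IsStratification d H₀ 𝒮) {S : Set (M × ℝ)} (hS : S ∈ 𝒮) {x : M × ℝ} (hx : x ∈ S)
    (hrk : EnergyRankOne d S) {ε : ℝ} (hε : 0 < ε) (hgap : IsSpectralGap H₀ x ε)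
    {U : Set (M × ℝ)} (hU : U ∈ 𝓝 x) :
    ∃ w : Set M, Cell.IsAdapted ⟨x, ε, w, S⟩ 𝒜 H₀ 𝒮 ∧
      w ×ˢ Metric.ball x.2 ε ∩ charVariety H₀ ⊆ U := by
  have : LocallyCompactSpace M := ChartedSpace.locallyCompactSpace (EuclideanSpace ℝ (Fin d)) M
  obtain ⟨μ, hμ⟩ := h𝒮.multiplicity S hS
  obtain ⟨w₀, W, h, δ, hδ, hx₀, hw₀, hh⟩ := exists_isLocalFrame hH₀ x.1 x.2 (hμ hx).2
  obtain ⟨X, w₁, hw₁, hx₁, hw₁₀, hX, hXp⟩ :=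
    hw₀.exists_vectorField hH₀.selfAdjoint hx₀ hδ hμ hx hrk
  obtain ⟨U₁, hU₁, hU₁S⟩ := h𝒮.nhds x
  -- A closed neighborhood keeps the closure of the trace inside `U₁`, as `adherent` demands.
  obtain ⟨U₂, hU₂, hU₂c, hU₂U⟩ := exists_mem_nhds_isClosed_subset (inter_mem hU hU₁)
  obtain ⟨w₂, hw₂, v, hv, hwv⟩ := mem_nhds_prod_iff.1 hU₂
  obtain ⟨η, hη, hηv⟩ := Metric.mem_nhds_iff.1 hv
  -- The three bounds serve respectively to stay in `U₂`, to stay in the energy window of the frame,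
  -- and to satisfy `gap`.
  obtain ⟨w₃, hw₃, hx₃, hw₃s⟩ := hgap.exists_nhds hH₀.isClosed
    (lt_min (lt_min hη hδ) (by positivity : (0 : ℝ) < ε / 10))
  obtain ⟨w₄, hw₄, hx₄, hw₄c⟩ := exists_isOpen_mem_isCompact_closure x.1
  have hhc : ∀ᶠ k in 𝓝 x.1, ‖h k - (x.2 : ℂ) • ContinuousLinearMap.id ℂ _‖ < ε := by
    have hc := hw₀.analytic_matrix.continuousOn.continuousAt (hw₀.isOpen.mem_nhds hx₀)
    have := hc.eventually (Metric.ball_mem_nhds (h x.1) hε)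
    refine this.mono fun k hk => ?_
    rw [hh, dist_eq_norm] at hk
    exact hk
  have hall : ∀ᶠ k in 𝓝 x.1, ‖h k - (x.2 : ℂ) • ContinuousLinearMap.id ℂ _‖ < ε ∧ k ∈ w₁ ∧
      k ∈ w₂ ∧ k ∈ w₃ ∧ k ∈ w₄ := by
    filter_upwards [hhc, hw₁.mem_nhds hx₁, hw₂, hw₃.mem_nhds hx₃, hw₄.mem_nhds hx₄]
      with k h1 h2 h3 h4 h5 using ⟨h1, h2, h3, h4, h5⟩
  obtain ⟨w, hw, hwo, hxw⟩ := eventually_nhds_iff.1 hall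
  have hsub : w ×ˢ Metric.ball x.2 ε ∩ charVariety H₀ ⊆ U₂ := by
    rintro ⟨k, l⟩ ⟨⟨hk, hl⟩, hkl⟩
    have := hw₃s k (hw k hk).2.2.2.1 l hkl hl
    exact hwv ⟨(hw k hk).2.2.1, hηv (lt_of_lt_of_le this
      ((min_le_left _ _).trans (min_le_left _ _)))⟩
  refine ⟨w, ⟨hε, hS, hx, hxw, hwo, ?_, fun k hk l hl hlε => ?_, fun S' hS' hne => ?_, hrk,
    μ, W, h, X, hμ, ?_, fun k hk => (hw k hk).1, ContMDiffOn.mono hX fun k hk => (hw k hk).2.1,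
    fun k hk => hXp k (hw k hk).2.1⟩, hsub.trans (hU₂U.trans inter_subset_left)⟩
  · exact hw₄c.of_isClosed_subset isClosed_closure (closure_mono fun k hk => (hw k hk).2.2.2.2)
  · exact lt_of_lt_of_le (hw₃s k (hw k hk).2.2.2.1 l hl hlε) (min_le_right _ _)
  · obtain ⟨y, hy, hyS⟩ := hne
    exact hU₁S S' hS' ⟨y, (hU₂U (closure_minimal hsub hU₂c hy)).2, hyS⟩
  · have hw' := hw₀.mono hwo fun k hk => hw₁₀ (hw k hk).2.1
    -- The window `δ` of the frame is replaced by `ε`, which may be larger: spectrum within `ε` is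
    -- already within `δ`, and other energies have no eigenvectors.
    refine { hw' with eigenspace_le := fun k hk l hl => ?_ }
    by_cases hs : l ∈ realSpectrum (H₀ k)
    · exact hw'.eigenspace_le k hk l (lt_of_lt_of_le (hw₃s k (hw k hk).2.2.2.1 l hs hl)
        ((min_le_left _ _).trans (min_le_right _ _)))
    · intro v hv
      rw [eq_zero_of_mem_eigenspace hs hv]
      exact Submodule.zero_mem _

namespace Cell.IsAdapted

variable {c c' : Cell M}

theorem center_mem_set (hc : c.IsAdapted 𝒜 H₀ 𝒮) : c.center ∈ c.set :=
  ⟨hc.center_mem_base, Metric.mem_ball_self hc.radius_pos⟩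

theorem isOpen_set (hc : c.IsAdapted 𝒜 H₀ 𝒮) : IsOpen c.set :=
  hc.isOpen_base.prod Metric.isOpen_ball

theorem spectralProj_eq_ball (hc : c.IsAdapted 𝒜 H₀ 𝒮) {k : M} (hk : k ∈ c.base) :
    spectralProj (H₀ k) c.interval =
      spectralProj (H₀ k) (Metric.ball c.center.2 (c.radius / 10)) := by
  refine spectralProj_congr (Metric.ball_subset_ball ?_) fun l hl hs => hc.gap k hk l hs hl
  linarith [hc.radius_pos]

/-- A common spectral point lies within a tenth of each radius of the respective center. The ball of
radius `c'.radius / 10`, which carries all the spectrum of `c'`, is thus inside the interval of `c`: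
at most three tenths of `c.radius` are used. -/
theorem spectralProj_comp (hc : c.IsAdapted 𝒜 H₀ 𝒮) (hc' : c'.IsAdapted 𝒜 H₀ 𝒮)
    (hr : c'.radius ≤ c.radius) (hne : (c.set ∩ c'.set ∩ charVariety H₀).Nonempty) {k : M}
    (hk : k ∈ c'.base) :
    spectralProj (H₀ k) c.interval ∘L spectralProj (H₀ k) c'.interval =
      spectralProj (H₀ k) c'.interval := by
  obtain ⟨y, ⟨⟨hy1, hy2⟩, hy3, hy4⟩, hy⟩ := hne
  have h1 := hc.gap y.1 hy1 y.2 hy hy2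
  have h2 := hc'.gap y.1 hy3 y.2 hy hy4
  rw [hc'.spectralProj_eq_ball hk]
  refine FiberedOperator.spectralProj_comp (Metric.ball_subset_ball' ?_)
  rw [Real.dist_eq, show c'.center.2 - c.center.2 = (y.2 - c.center.2) - (y.2 - c'.center.2) by ring]
  have h3 := abs_sub (y.2 - c.center.2) (y.2 - c'.center.2)
  linarith [hc.radius_pos]

/-- The spectral projections over overlapping cells of the same multiplicity agree. -/
theorem spectralProj_comp_symm (hH₀ : IsAnalyticallyFibered 𝒜 H₀)
    (hc : c.IsAdapted 𝒜 H₀ 𝒮) (hc' : c'.IsAdapted 𝒜 H₀ 𝒮)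
    (hr : c'.radius ≤ c.radius) (hne : (c.set ∩ c'.set ∩ charVariety H₀).Nonempty) {k : M}
    (hk : k ∈ c.base) (hk' : k ∈ c'.base) {μ : ℕ} (hμ : c.stratum ⊆ multStratum H₀ μ)
    (hμ' : c'.stratum ⊆ multStratum H₀ μ) :
    spectralProj (H₀ k) c'.interval ∘L spectralProj (H₀ k) c.interval =
      spectralProj (H₀ k) c.interval := by
  obtain ⟨ν, W, h, -, hν, hw, hh, -⟩ := hc.exists_frame
  obtain ⟨ν', W', h', -, hν', hw', hh', -⟩ := hc'.exists_frame
  obtain rfl := multStratum_inj ⟨_, hc.center_mem⟩ hμ hν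
  obtain rfl := multStratum_inj ⟨_, hc'.center_mem⟩ hμ' hν'
  have h1 := hc.spectralProj_comp hc' hr hne hk'
  have h2 := hw.spectralProj_eq (hH₀.selfAdjoint k) hk (hh k hk)
  have h3 := hw'.spectralProj_eq (hH₀.selfAdjoint k) hk' (hh' k hk')
  unfold Cell.interval at h1 ⊢
  rw [h2, h3] at h1 ⊢
  -- Nesting gives one inclusion of ranges, and equality of dimensions makes it an equality.
  have hle : LinearMap.range (W' k : EuclideanSpace ℂ (Fin μ) →ₗ[ℂ] F k) ≤
      LinearMap.range (W k : EuclideanSpace ℂ (Fin μ) →ₗ[ℂ] F k) := by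
    rintro _ ⟨u, rfl⟩
    have h4 := DFunLike.congr_fun h1 (W' k u)
    have h5 := adjoint_apply_apply (hw'.isometry k hk') u
    simp only [ContinuousLinearMap.comp_apply, h5] at h4
    exact ⟨_, h4⟩
  have heq := Submodule.eq_of_le_of_finrank_eq hle
    ((hw'.finrank_range hk').trans (hw.finrank_range hk).symm)
  ext v
  have h6 : W k (ContinuousLinearMap.adjoint (W k) v) ∈
      LinearMap.range (W' k : EuclideanSpace ℂ (Fin μ) →ₗ[ℂ] F k) := heq ▸ ⟨_, rfl⟩
  obtain ⟨u, hu⟩ := h6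
  have hu' : W' k u = W k (ContinuousLinearMap.adjoint (W k) v) := hu
  simp only [ContinuousLinearMap.comp_apply, ← hu', adjoint_apply_apply (hw'.isometry k hk') u]

/-- The family consists of all strata that meet the cell. They all adhere to the center, so by the
frontier condition each is the stratum of the center or has it in its frontier. -/
theorem isAssociatedStratum (h𝒮 : IsStratification d H₀ 𝒮) (hc : c.IsAdapted 𝒜 H₀ 𝒮) {I : Set ℝ}
    (hI : c.center.2 ∈ closure I) : IsAssociatedStratum H₀ 𝒮 I c.set c.stratum := by
  have hadh : ∀ S ∈ 𝒮, (c.set ∩ S).Nonempty → c.center ∈ closure S := fun S hS ⟨y, hy, hyS⟩ =>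
    hc.adherent S hS ⟨y, subset_closure ⟨hy, h𝒮.subset_charVariety hS hyS⟩, hyS⟩
  have hcv := h𝒮.subset_charVariety hc.stratum_mem hc.center_mem
  have hne : (c.set ∩ c.stratum).Nonempty := ⟨_, hc.center_mem_set, hc.center_mem⟩
  refine ⟨hne, {S ∈ 𝒮 | (c.set ∩ S).Nonempty}, ?_, ?_, ⟨hc.stratum_mem, hne⟩, ?_, ?_⟩
  · exact (h𝒮.finite_closure c.center).subset fun S hS => ⟨hS.1, hadh S hS.1 hS.2⟩
  · exact fun S hS => ⟨hS.1, c.center, hadh S hS.1 hS.2, hcv, hI⟩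
  · ext y
    simp only [mem_inter_iff, mem_iUnion, exists_prop]
    constructor
    · rintro ⟨hy, hyv⟩
      rw [← h𝒮.sUnion_eq] at hyv
      obtain ⟨S, hS, hyS⟩ := hyv
      exact ⟨S, ⟨hS, y, hy, hyS⟩, hy, hyS⟩
    · rintro ⟨S, ⟨hS, -⟩, hy, hyS⟩
      exact ⟨hy, h𝒮.subset_charVariety hS hyS⟩
  · intro S hS
    rcases h𝒮.eq_or_subset hc.stratum_mem hS.1 hc.center_mem (hadh S hS.1 hS.2) with h | h
    · exact Or.inl h.symm
    · exact Or.inr h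

end Cell.IsAdapted

/-- The cell `c` has a smaller stratum and a longer energy interval than the cell `c'`, or the
strata agree. -/
def Cell.Precedes (c c' : Cell M) : Prop :=
  c.stratum = c'.stratum ∨
    (c.stratum ⊆ closure c'.stratum \ c'.stratum ∧ c'.radius ≤ c.radius)

end Cells

/-! ### Covering a compact set by comparable cells, one stratum at a time. -/

section Covering

variable {d : ℕ} {M : Type*} [TopologicalSpace M] [ChartedSpace (EuclideanSpace ℝ (Fin d)) M]
  [IsManifold (𝓡 d) ω M] [T2Space M]
  {F : M → Type*} [∀ k, NormedAddCommGroup (F k)] [∀ k, InnerProductSpace ℂ (F k)]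
  [∀ k, CompleteSpace (F k)]
  {H' : Type*} [NormedAddCommGroup H'] [InnerProductSpace ℂ H'] [CompleteSpace H']
  {𝒜 : HilbertBundleAtlas d F H'} {H₀ : ∀ k, F k →ₗ.[ℂ] F k} {𝒮 : Set (Set (M × ℝ))}

/-- A finite family of adapted cells centered in `K`, with energy intervals in `I'` and strata
in `s`, which covers the part of `K` in the strata of `s`; overlapping cells are comparable. -/
structure IsCellCover (𝒜 : HilbertBundleAtlas d F H') (H₀ : ∀ k, F k →ₗ.[ℂ] F k)
    (𝒮 : Set (Set (M × ℝ))) (K : Set (M × ℝ)) (I' : Set ℝ) (s : Set (Set (M × ℝ)))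
    (𝒞 : Set (Cell M)) : Prop where
  finite : 𝒞.Finite
  adapted : ∀ c ∈ 𝒞, c.IsAdapted 𝒜 H₀ 𝒮
  center_mem : ∀ c ∈ 𝒞, c.center ∈ K
  closedBall_subset : ∀ c ∈ 𝒞, Metric.closedBall c.center.2 c.radius ⊆ I'
  stratum_mem : ∀ c ∈ 𝒞, c.stratum ∈ s
  cover : ∀ S ∈ s, K ∩ S ⊆ ⋃ c ∈ 𝒞, c.set
  comparable : ∀ c ∈ 𝒞, ∀ c' ∈ 𝒞, (c.set ∩ c'.set ∩ charVariety H₀).Nonempty →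
    c.Precedes c' ∨ c'.Precedes c

/-- What remains of `K ∩ a` is covered by new cells centered on `a`, with radii below all the old
ones. They are disjoint, on the variety, from old cells whose strata are not in the frontier of `a`,
so any overlap of old and new is comparable. -/
theorem IsStratification.exists_cellCover_insert (h𝒮 : IsStratification d H₀ 𝒮)
    (hH₀ : IsAnalyticallyFibered 𝒜 H₀) {K : Set (M × ℝ)} (hK : IsCompact K)
    (hKv : K ⊆ charVariety H₀) {I' : Set ℝ} (hI' : IsOpen I') (hKI : ∀ x ∈ K, x.2 ∈ I')
    (hτ : ∀ x ∈ K, x.2 ∉ thresholds d 𝒮) {s : Set (Set (M × ℝ))} {a : Set (M × ℝ)} (ha : a ∈ 𝒮)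
    (has : a ∉ s) (hlow : ∀ S ∈ 𝒮, (S ∩ K).Nonempty → S ⊆ closure a \ a → S ∈ s)
    {𝒞 : Set (Cell M)} (h𝒞 : IsCellCover 𝒜 H₀ 𝒮 K I' s 𝒞) :
    ∃ 𝒞', IsCellCover 𝒜 H₀ 𝒮 K I' (insert a s) 𝒞' := by
  set K' : Set (M × ℝ) := (K ∩ a) \ ⋃ c ∈ 𝒞, c.set with hK'
  have hKc : IsCompact K' := by
    have hopen : IsOpen (⋃ c ∈ 𝒞, c.set) :=
      isOpen_biUnion fun c hc => (h𝒞.adapted c hc).isOpen_set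
    -- The frontier of `a` within `K` is already covered, so replacing `a` by its closure changes
    -- nothing and gives compactness.
    have : K' = (K ∩ closure a) \ ⋃ c ∈ 𝒞, c.set := by
      refine Subset.antisymm (sdiff_subset_sdiff_left (inter_subset_inter_right _ subset_closure)) ?_
      rintro y ⟨⟨hyK, hya⟩, hyc⟩
      refine ⟨⟨hyK, ?_⟩, hyc⟩
      have hy := hKv hyK
      rw [← h𝒮.sUnion_eq] at hy
      obtain ⟨S, hS, hyS⟩ := hy
      rcases h𝒮.eq_or_subset hS ha hyS hya with rfl | h
      · exact hyS
      · exact absurd (h𝒞.cover S (hlow S hS ⟨y, hyS, hyK⟩ h) ⟨hyK, hyS⟩) hyc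
    rw [this]
    exact (hK.inter_right isClosed_closure).diff hopen
  have hex : ∀ x ∈ K', ∃ c : Cell M, c.center = x ∧ c.stratum = a ∧ c.IsAdapted 𝒜 H₀ 𝒮 ∧
      Metric.closedBall c.center.2 c.radius ⊆ I' ∧ (∀ c' ∈ 𝒞, c.radius ≤ c'.radius) ∧
      ∀ c' ∈ 𝒞, ¬ c'.stratum ⊆ closure a \ a → Disjoint (c.set ∩ charVariety H₀)
        (c'.set ∩ charVariety H₀) := by
    rintro x ⟨⟨hxK, hxa⟩, -⟩
    obtain ⟨μ, hμ⟩ := h𝒮.multiplicity a ha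
    obtain ⟨r, hr, hrI⟩ := Metric.nhds_basis_closedBall.mem_iff.1 (hI'.mem_nhds (hKI x hxK))
    have h1 : ∀ᶠ ε in 𝓝[>] (0 : ℝ), Metric.closedBall x.2 ε ⊆ I' :=
      nhdsWithin_le_nhds ((eventually_le_nhds hr).mono fun ε h =>
        (Metric.closedBall_subset_closedBall h).trans hrI)
    have h2 : ∀ᶠ ε in 𝓝[>] (0 : ℝ), ∀ c' ∈ 𝒞, ε ≤ c'.radius :=
      (eventually_all_finite h𝒞.finite).2 fun c hc =>
        nhdsWithin_le_nhds (eventually_le_nhds (h𝒞.adapted c hc).radius_pos)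
    obtain ⟨ε, hε, h1, h2, h3⟩ := (eventually_mem_nhdsWithin.and (h1.and (h2.and
      (hH₀.eventually_isSpectralGap (hμ hxa))))).exists
    have hU : ∀ᶠ y in 𝓝 x, ∀ c ∈ 𝒞, ¬ c.stratum ⊆ closure a \ a →
        y ∉ closure (c.set ∩ charVariety H₀) := by
      refine (eventually_all_finite h𝒞.finite).2 fun c hc => ?_
      by_cases hca : c.stratum ⊆ closure a \ a
      · exact Eventually.of_forall fun y h => absurd hca h
      -- Otherwise `adherent` would put the center of `c` in the closure of `a`, and its stratum
      -- would be `a`, which is not in `s`, or lie in the frontier of `a`.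
      have hx : x ∉ closure (c.set ∩ charVariety H₀) := fun hx => by
        have h4 := (h𝒞.adapted c hc).adherent a ha ⟨x, hx, hxa⟩
        rcases h𝒮.eq_or_subset (h𝒞.adapted c hc).stratum_mem ha (h𝒞.adapted c hc).center_mem h4
          with h | h
        · exact has (h ▸ h𝒞.stratum_mem c hc)
        · exact hca h
      filter_upwards [isClosed_closure.isOpen_compl.mem_nhds hx] with y hy _ using hy
    obtain ⟨w, hw, hwU⟩ := exists_adapted_cell hH₀ h𝒮 ha hxa
      (h𝒮.energyRankOne ha hxa (hτ x hxK)) hε h3 hU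
    refine ⟨⟨x, ε, w, a⟩, rfl, rfl, hw, h1, h2, fun c hc hca => ?_⟩
    rw [disjoint_left]
    intro y hy hyc
    have : ∀ c ∈ 𝒞, ¬ c.stratum ⊆ closure a \ a → y ∉ closure (c.set ∩ charVariety H₀) := hwU hy
    exact this c hc hca (subset_closure hyc)
  choose f hfc hfS hfA hfI hfr hfd using hex
  obtain ⟨t, ht⟩ := hKc.elim_nhds_subcover' (fun x hx => (f x hx).set) fun x hx => by
    have := (hfA x hx).isOpen_set.mem_nhds (hfA x hx).center_mem_set
    rwa [hfc x hx] at this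
  set 𝒩 : Set (Cell M) := (fun x : K' => f x.1 x.2) '' (t : Set K') with h𝒩
  have hN : ∀ c ∈ 𝒩, c.stratum = a ∧ c.IsAdapted 𝒜 H₀ 𝒮 ∧ c.center ∈ K' ∧
      Metric.closedBall c.center.2 c.radius ⊆ I' ∧ (∀ c' ∈ 𝒞, c.radius ≤ c'.radius) ∧
      ∀ c' ∈ 𝒞, ¬ c'.stratum ⊆ closure a \ a → Disjoint (c.set ∩ charVariety H₀)
        (c'.set ∩ charVariety H₀) := by
    rintro _ ⟨x, -, rfl⟩
    exact ⟨hfS _ _, hfA _ _, (hfc x.1 x.2).symm ▸ x.2, hfI _ _, hfr _ _, hfd _ _⟩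
  have hcomp : ∀ c ∈ 𝒞, ∀ c' ∈ 𝒩, (c'.set ∩ c.set ∩ charVariety H₀).Nonempty →
      c.Precedes c' := by
    rintro c hc c' hc' ⟨y, ⟨hy', hy⟩, hyv⟩
    obtain ⟨h1, -, -, -, h2, h3⟩ := hN c' hc'
    refine Or.inr ⟨?_, h2 c hc⟩
    rw [h1]
    by_contra hca
    exact disjoint_left.1 (h3 c hc hca) ⟨hy', hyv⟩ ⟨hy, hyv⟩
  refine ⟨𝒞 ∪ 𝒩, h𝒞.finite.union (t.finite_toSet.image _), ?_, ?_, ?_, ?_, ?_, ?_⟩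
  · rintro c (hc | hc)
    exacts [h𝒞.adapted c hc, (hN c hc).2.1]
  · rintro c (hc | hc)
    exacts [h𝒞.center_mem c hc, (hN c hc).2.2.1.1.1]
  · rintro c (hc | hc)
    exacts [h𝒞.closedBall_subset c hc, (hN c hc).2.2.2.1]
  · rintro c (hc | hc)
    exacts [Or.inr (h𝒞.stratum_mem c hc), Or.inl (hN c hc).1]
  · rintro S (rfl | hS) y hy
    · by_cases hyc : y ∈ ⋃ c ∈ 𝒞, c.set
      · exact biUnion_subset_biUnion_left subset_union_left hyc
      · obtain ⟨x, hx, hyx⟩ := mem_iUnion₂.1 (ht ⟨hy, hyc⟩)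
        exact mem_biUnion (Or.inr ⟨x, hx, rfl⟩) hyx
    · exact biUnion_subset_biUnion_left subset_union_left (h𝒞.cover S hS hy)
  · rintro c (hc | hc) c' (hc' | hc') hne
    · exact h𝒞.comparable c hc c' hc' hne
    · exact Or.inl (hcomp c hc c' hc' (by rwa [inter_comm c'.set]))
    · exact Or.inr (hcomp c' hc' c hc hne)
    · exact Or.inl (Or.inl ((hN c hc).1.trans (hN c' hc').1.symm))

/-- The strata meeting `K` are finite in number and are added by increasing `rk`, the number of them
in the frontier. Since `rk` strictly increases along the frontier order, a stratum of maximal `rk`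
is in the frontier of no other, and removing it leaves a family closed under passing to frontier
strata. -/
theorem IsStratification.exists_cellCover (h𝒮 : IsStratification d H₀ 𝒮)
    (hH₀ : IsAnalyticallyFibered 𝒜 H₀) {K : Set (M × ℝ)} (hK : IsCompact K)
    (hKv : K ⊆ charVariety H₀) {I' : Set ℝ} (hI' : IsOpen I') (hKI : ∀ x ∈ K, x.2 ∈ I')
    (hτ : ∀ x ∈ K, x.2 ∉ thresholds d 𝒮) :
    ∃ 𝒞, IsCellCover 𝒜 H₀ 𝒮 K I' {S ∈ 𝒮 | (S ∩ K).Nonempty} 𝒞 := by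
  classical
  have hfin := h𝒮.finite_inter hK
  set 𝒯 : Set (Set (M × ℝ)) := {S ∈ 𝒮 | (S ∩ K).Nonempty} with h𝒯
  let rk : Set (M × ℝ) → ℕ := fun S => {S' ∈ 𝒯 | S' ⊆ closure S \ S}.ncard
  have hrk : ∀ S ∈ 𝒯, ∀ S' ∈ 𝒯, S ⊆ closure S' \ S' → rk S < rk S' := by
    intro S hS S' hS' h
    refine ncard_lt_ncard ?_ (hfin.subset fun _ h => h.1)
    refine ⟨fun T hT => ⟨hT.1, h𝒮.trans hT.1.1 hS'.1 hT.2 h⟩, fun hsub => ?_⟩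
    have : S ⊆ closure S \ S := (hsub ⟨hS, h⟩).2
    exact h𝒮.asymm hS.1 this this
  have key : ∀ s : Finset (Set (M × ℝ)), (s : Set (Set (M × ℝ))) ⊆ 𝒯 →
      (∀ S ∈ s, ∀ S' ∈ 𝒯, S' ⊆ closure S \ S → S' ∈ s) →
      ∃ 𝒞, IsCellCover 𝒜 H₀ 𝒮 K I' s 𝒞 := by
    intro s
    induction s using Finset.induction_on_max_value rk with
    | empty =>
      intro _ _
      exact ⟨∅, finite_empty, by simp, by simp, by simp, by simp, by simp, by simp⟩
    | insert a s has hmax ih =>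
      intro hsub hdown
      have ha : a ∈ 𝒯 := hsub (by simp)
      have hs : (s : Set (Set (M × ℝ))) ⊆ 𝒯 := fun S hS => hsub (by simp [Finset.mem_coe.1 hS])
      obtain ⟨𝒞, h𝒞⟩ := ih hs fun S hS S' hS' h => by
        rcases Finset.mem_insert.1 (hdown S (Finset.mem_insert_of_mem hS) S' hS' h) with rfl | h'
        · exact absurd (hrk _ hS' S (hs hS) h) (hmax S hS).not_gt
        · exact h'
      rw [Finset.coe_insert]
      refine h𝒮.exists_cellCover_insert hH₀ hK hKv hI' hKI hτ ha.1 (by simpa using has) ?_ h𝒞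
      intro S hS hSK h
      rcases Finset.mem_insert.1 (hdown a (Finset.mem_insert_self _ _) S ⟨hS, hSK⟩ h) with rfl | h'
      · exact (h𝒮.asymm hS h h).elim
      · exact h'
  have := key hfin.toFinset (by simp) (by simp [h𝒯]; tauto)
  rwa [hfin.coe_toFinset] at this

end Covering

theorem isOpenInterval_ball (a r : ℝ) : IsOpenInterval (Metric.ball a r) := by
  rw [Real.ball_eq_Ioo]
  exact ⟨isOpen_Ioo, ordConnected_Ioo⟩

theorem compactlyIn_ball {a r : ℝ} {B : Set ℝ} (h : Metric.closedBall a r ⊆ B) :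
    CompactlyIn (Metric.ball a r) B :=
  ⟨(isCompact_closedBall a r).of_isClosed_subset isClosed_closure Metric.closure_ball_subset_closedBall,
    Metric.closure_ball_subset_closedBall.trans h⟩

end FiberedOperator

end

/-! ### The proposition, assembled from a finite cell cover. -/

open FiberedOperator in
theorem mainTheorem3 {d : ℕ} {M : Type*} [TopologicalSpace M] [T2Space M]
    [SecondCountableTopology M] [ChartedSpace (EuclideanSpace ℝ (Fin d)) M]
    [IsManifold (𝓡 d) ω M]
    {H' : Type*} [NormedAddCommGroup H'] [InnerProductSpace ℂ H'] [CompleteSpace H']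
    {F : M → Type*} [∀ k, NormedAddCommGroup (F k)] [∀ k, InnerProductSpace ℂ (F k)]
    [∀ k, CompleteSpace (F k)]
    (𝒜 : HilbertBundleAtlas d F H') (H₀ : ∀ k, F k →ₗ.[ℂ] F k)
    (hH₀ : IsAnalyticallyFibered 𝒜 H₀)
    (𝒮 : Set (Set (M × ℝ))) (h𝒮 : IsStratification d H₀ 𝒮)
    (I I' : Set ℝ) (hI : IsOpenInterval I) (hI' : IsOpenInterval I')
    (hII' : CompactlyIn I I') (hI'τ : CompactlyIn I' (thresholds d 𝒮)ᶜ) :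
    ∃ (MI : ℕ) (N : Fin MI → ℕ) (w : Fin MI → Set M) (J : ∀ m, Fin (N m) → Set ℝ)
      (S : ∀ m, Fin (N m) → Set (M × ℝ)) (μ : ∀ m, Fin (N m) → ℕ),
      (∀ m, IsOpen (w m) ∧ CompactlyIn (w m) univ) ∧
      (∀ m n, IsOpenInterval (J m n) ∧ CompactlyIn (J m n) I') ∧
      -- the cells cover the part of the characteristic variety over the closure of `I`
      energyPreimage H₀ (closure I) ⊆ ⋃ m, ⋃ n, w m ×ˢ J m n ∧
      -- the energy intervals over a given base set are disjoint
      (∀ m n n', n ≠ n' → J m n ∩ J m n' = ∅) ∧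
      -- unique associated stratum
      (∀ m n, IsAssociatedStratum H₀ 𝒮 I (w m ×ˢ J m n) (S m n) ∧
        (∀ S', IsAssociatedStratum H₀ 𝒮 I (w m ×ˢ J m n) S' → S' = S m n) ∧
        EnergyRankOne d (S m n)) ∧
      -- spectral projections of constant rank
      (∀ m n,
        (∀ k ∈ w m, (spectralProj (H₀ k) (J m n)).rank = μ m n) ∧
        ∃ J' : Set ℝ, IsOpenInterval J' ∧ CompactlyIn J' (J m n) ∧
          ∀ k ∈ w m, spectralProj (H₀ k) (J m n) = spectralProj (H₀ k) J') ∧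
      -- analytic unitary trivialization, and analytic vector field
      (∀ m n, ∃ (W : ∀ k, EuclideanSpace ℂ (Fin (μ m n)) →L[ℂ] F k)
        (Ht : M → (EuclideanSpace ℂ (Fin (μ m n)) →L[ℂ] EuclideanSpace ℂ (Fin (μ m n))))
        (A : ∀ k, F k →L[ℂ] F k),
        𝒜.IsAnalyticHom (w m) W ∧
        (∀ k ∈ w m, (∀ x, ‖W k x‖ = ‖x‖) ∧
          range (W k) = range (spectralProj (H₀ k) (J m n))) ∧
        (∀ k ∈ w m, IsSpectralPart (H₀ k) (J m n) (A k)) ∧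
        (∀ k ∈ w m, Ht k = ContinuousLinearMap.adjoint (W k) ∘L A k ∘L W k) ∧
        ContMDiffOn (𝓡 d) 𝓘(ℝ, EuclideanSpace ℂ (Fin (μ m n)) →L[ℂ]
          EuclideanSpace ℂ (Fin (μ m n))) ω Ht (w m) ∧
        ∃ X : ∀ k : M, TangentSpace (𝓡 d) k, IsAnalyticVectorField (w m) X ∧
          (∀ k ∈ w m, (derivAlong X Ht k - (1 / 2 : ℂ) •
            ContinuousLinearMap.id ℂ (EuclideanSpace ℂ (Fin (μ m n)))).IsPositive) ∧
          ∃ B : ∀ k, F k →L[ℂ] F k,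
            IsEndCovDeriv 𝒜 (w m) W X (fun k => spectralProj (H₀ k) (J m n)) A B ∧
            ∀ k ∈ w m, (B k - (1 / 2 : ℂ) • spectralProj (H₀ k) (J m n)).IsPositive) ∧
      -- classification of the overlapping cells
      (∀ m n m' n',
        ((w m ×ˢ J m n) ∩ (w m' ×ˢ J m' n') ∩ charVariety H₀).Nonempty → μ m' n' ≤ μ m n →
        (∀ k ∈ w m ∩ w m', spectralProj (H₀ k) (J m n) ∘L spectralProj (H₀ k) (J m' n') =
          spectralProj (H₀ k) (J m' n')) ∧
        (S m n ⊆ closure (S m' n') \ S m' n' ∨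
          (S m' n' ⊆ closure (S m n) \ S m n ∧ μ m n = μ m' n') ∨
          (S m' n' = S m n ∧ μ m n = μ m' n'))) := by
  obtain ⟨𝒞, h𝒞⟩ := h𝒮.exists_cellCover hH₀ (hH₀.isCompact hII'.1) (fun x hx => hx.1) hI'.1
    (fun x hx => hII'.2 hx.2) (fun x hx => hI'τ.2 (subset_closure (hII'.2 hx.2)))
  have := h𝒞.finite.to_subtype
  obtain ⟨n, ⟨e⟩⟩ := Finite.exists_equiv_fin 𝒞
  let c : Fin n → Cell M := fun m => e.symm m
  have hc : ∀ m, c m ∈ 𝒞 := fun m => (e.symm m).2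
  have hA : ∀ m, (c m).IsAdapted 𝒜 H₀ 𝒮 := fun m => h𝒞.adapted _ (hc m)
  choose μ W h X hμ hw hh hX hXp using fun m => (hA m).exists_frame
  have hP : ∀ m, ∀ k ∈ (c m).base, spectralProj (H₀ k) (c m).interval =
      W m k ∘L ContinuousLinearMap.adjoint (W m k) := fun m k hk =>
    (hw m).spectralProj_eq (hH₀.selfAdjoint k) hk (hh m k hk)
  -- Each base set carries a single energy interval, so disjointness over a base is vacuous; a set
  -- may recur as base of several cells.
  refine ⟨n, fun _ => 1, fun m => (c m).base, fun m _ => (c m).interval,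
    fun m _ => (c m).stratum, fun m _ => μ m, fun m => ⟨(hA m).isOpen_base,
      (hA m).isCompact_closure, subset_univ _⟩,
    fun m _ => ⟨isOpenInterval_ball _ _, compactlyIn_ball (h𝒞.closedBall_subset _ (hc m))⟩,
    ?_, fun m i j hij => absurd (Subsingleton.elim i j) hij, ?_, ?_, ?_, ?_⟩
  · intro x hx
    have hxv := hx.1
    rw [← h𝒮.sUnion_eq] at hxv
    obtain ⟨S, hS, hxS⟩ := hxv
    obtain ⟨a, ha, hxa⟩ := mem_iUnion₂.1 (h𝒞.cover S ⟨hS, x, hxS, hx⟩ ⟨hx, hxS⟩)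
    refine mem_iUnion.2 ⟨e ⟨a, ha⟩, mem_iUnion.2 ⟨0, ?_⟩⟩
    have hca : c (e ⟨a, ha⟩) = a := congrArg Subtype.val (e.symm_apply_apply ⟨a, ha⟩)
    change x ∈ (c (e ⟨a, ha⟩)).set
    rwa [hca]
  · intro m _
    have h1 := (hA m).isAssociatedStratum h𝒮 (h𝒞.center_mem _ (hc m)).2
    exact ⟨h1, fun S' h2 => h𝒮.associated_unique h1 h2, (hA m).energyRankOne⟩
  · intro m _
    refine ⟨fun k hk => ?_, Metric.ball (c m).center.2 ((c m).radius / 10),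
      isOpenInterval_ball _ _, compactlyIn_ball ?_, fun k hk => (hA m).spectralProj_eq_ball hk⟩
    · rw [hP m k hk]
      refine (congrArg (fun S : Submodule ℂ (F k) => Module.rank ℂ S)
        (range_comp_adjoint ((hw m).isometry k hk))).trans ?_
      exact (Module.finrank_eq_rank ℂ _).symm.trans
        (congrArg Nat.cast ((hw m).finrank_range hk))
    · refine Metric.closedBall_subset_ball ?_
      linarith [(hA m).radius_pos]
  · intro m _
    refine ⟨W m, h m, fun k => W m k ∘L h m k ∘L ContinuousLinearMap.adjoint (W m k),
      (hw m).analytic_frame, fun k hk => ⟨norm_map_of_adjoint_comp ((hw m).isometry k hk), ?_⟩,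
      fun k hk v => ?_, fun k hk => ?_, (hw m).analytic_matrix, X m, hX m, hXp m, _,
      (hw m).isEndCovDeriv (X m) (hP m) (fun k _ => rfl), fun k hk => ?_⟩
    · have h1 := range_comp_adjoint ((hw m).isometry k hk)
      rw [← hP m k hk] at h1
      exact (congrArg (fun S : Submodule ℂ (F k) => (S : Set (F k))) h1).symm
    · rw [hP m k hk]
      exact (hw m).intertwines k hk _
    · have h1 := adjoint_apply_apply ((hw m).isometry k hk)
      ext1 a
      simp only [ContinuousLinearMap.comp_apply, h1]
    · rw [hP m k hk]
      exact isPositive_conj_sub (hXp m k hk) (W m k)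
  · intro m _ m' _ hne hle
    have hne' : ((c m').set ∩ (c m).set ∩ charVariety H₀).Nonempty := by
      rwa [inter_comm (c m').set]
    have heq : μ m = μ m' → ∀ k ∈ (c m).base ∩ (c m').base,
        spectralProj (H₀ k) (c m).interval ∘L spectralProj (H₀ k) (c m').interval =
          spectralProj (H₀ k) (c m').interval := by
      intro hmm k hk
      rcases le_total (c m').radius (c m).radius with h1 | h1
      · exact (hA m).spectralProj_comp (hA m') h1 hne hk.2
      -- The radii are ordered the wrong way here; equality of the multiplicities reverses the
      -- nesting.
      · exact (hA m').spectralProj_comp_symm hH₀ (hA m) h1 hne' hk.2 hk.1 (hμ m') (hmm ▸ hμ m)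
    have hsame : (c m).stratum = (c m').stratum → μ m = μ m' := fun hs =>
      multStratum_inj ⟨_, (hA m).center_mem⟩ (hμ m) (hs ▸ hμ m')
    rcases h𝒞.comparable _ (hc m) _ (hc m') hne with (hs | ⟨hs, hr⟩) | (hs | ⟨hs, hr⟩)
    · exact ⟨heq (hsame hs), Or.inr (Or.inr ⟨hs.symm, hsame hs⟩)⟩
    · exact ⟨fun k hk => (hA m).spectralProj_comp (hA m') hr hne hk.2, Or.inl hs⟩
    · exact ⟨heq (hsame hs.symm), Or.inr (Or.inr ⟨hs, hsame hs.symm⟩)⟩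
    -- The stratum of `c m'` is in the frontier of that of `c m`, so its multiplicity is at least `μ
    -- m`; with `hle` the two agree.
    · have hmm : μ m = μ m' :=
        le_antisymm (h𝒮.multiplicity_le hH₀ (hA m').stratum_mem (hμ m') (hμ m) hs) hle
      exact ⟨heq hmm, Or.inr (Or.inl ⟨hs, hmm⟩)⟩
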